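/- Let $d,k,T\ge 1$ and let $X\subset\mathbb Z^d\times\{0,\dots,T-1\}^k$; write $i=(i^d,i^k)$ for its points. Let $X$ be $T$-periodic in $e_1,\dots,e_d$. Let $\mathcal E\subset X\times X$ be $T$-periodic in $e_1,\dots,e_d$, with $\sup\{|i-j|:(i,j)\in\mathcal E\}<\infty$, and such that any two points of $X$ are joined by a finite sequence of points of $X$ whose consecutive pairs belong to $\mathcal E$. Let $a_{ij}$ ($i,j\in X$) satisfy $a_{i+Te_m\,j+Te_m}=a_{ij}$ for $m=1,\dots,d$, $a_{ij}>0$ if $(i,j)\in\mathcal E$, and $a_{ij}=0$ otherwise. For $A\subset\mathbb R^d$, $\varepsilon>0$ and a discrete function $u=(u_i)_{i\in X}$ ($u_i$ being the value at $\varepsilon i$), set $$F_\varepsilon(u;A)=\sum_{i,j\in X,\ \varepsilon i^d,\,\varepsilon j^d\in A}\varepsilon^{d-2}a_{ij}(u_i-u_j)^2 .$$ For $\Omega\subset\mathbb R^d$ open and a family of discrete functions $u_\varepsilon=(u_i^\varepsilon)_{i\in X}$, let $\overline u_\varepsilon$ be the function which, on each cube $\varepsilon(lT+[0,T)^d)\subset\Omega$,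 $l\in\mathbb Z^d$, is equal to the mean of the $u^\varepsilon_i$ over the $i\in X$ with $i^d\in lT+[0,T)^d$, and which is $0$ elsewhere. We say that $u_\varepsilon$ converges to $u$ if $\overline u_\varepsilon\to u$ in $L^2_{\rm loc}(\Omega)$ as $\varepsilon\to0^+$. For $\delta>0$ put $A(\delta)=\{x\in A:\operatorname{dist}(x,\partial A)>\delta\}$. **Lemma.** Let $\Omega\subset\mathbb R^d$ be an open set with Lipschitz boundary and let $A\subset\Omega$ be a bounded open set with Lipschitz boundary. Let $u\in H^1(\Omega)$, extended outside $\Omega$ (if $\overline A\not\subset\Omega$) so that it is $H^1$ in an open neighbourhood of $\overline A$, and let $v^\varepsilon_i=\varepsilon^{-d}\int_{\varepsilon i^d+\varepsilon[0,1)^d}u(x)\,dx$. Let $u_\varepsilon$ converge to $u$, with $F_\varepsilon(u_\varepsilon;A)$ bounded uniformly for small $\varepsilon$. Then for every $\delta>0$ there is a family $w_\varepsilon=w^\delta_\varepsilon$ converging to $u$ such that, for every $\varepsilon>0$ and $i\in X$, $$w^\varepsilon_i=u^\varepsilon_i\ \text{ if }\varepsilon i^d\in A(2\delta),\qquad w^\varepsilon_i=v^\varepsilon_i\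 \text{ if }\varepsilon i^d\in A\setminus A(\delta),$$ and such that $$\limsup_{\varepsilon\to0^+}\bigl(F_\varepsilon(w^\delta_\varepsilon;A)-F_\varepsilon(u_\varepsilon;A)\bigr)\le \rho(\delta)$$ for some $\rho:(0,\infty)\to\mathbb R$ with $\rho(\delta)\to0$ as $\delta\to0^+$. -/

import Mathlib

open Set Filter Topology MeasureTheory
open scoped ContDiff

/-- Nodes `i = (i^d, i^k) ∈ ℤ^d × ℤ^k`. -/
abbrev Node (d k : ℕ) : Type := (Fin d → ℤ) × (Fin k → ℤ)

/-- The translation `i ↦ i + T e_m`, for `m` one of the first `d` directions. -/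
def Node.shift {d k : ℕ} (T : ℕ) (m : Fin d) (i : Node d k) : Node d k :=
  (i.1 + Pi.single m (T : ℤ), i.2)

/-- The Euclidean distance `|i - j|` in `ℝ^d × ℝ^k`. -/
noncomputable def Node.eucDist {d k : ℕ} (i j : Node d k) : ℝ :=
  Real.sqrt (∑ m, ((i.1 m : ℝ) - j.1 m) ^ 2 + ∑ n, ((i.2 n : ℝ) - j.2 n) ^ 2)

/-- A `T`-periodic connected network with bounded range of interactions: a set of nodes
`X ⊆ ℤ^d × {0, …, T-1}^k`, a set of edges `E ⊆ X × X`, and coefficients `a i j`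
(only their values for `i, j ∈ X` matter). -/
structure PeriodicNetwork (d k T : ℕ) where
  X : Set (Node d k)
  E : Set (Node d k × Node d k)
  a : Node d k → Node d k → ℝ
  X_thin : ∀ i ∈ X, ∀ n, 0 ≤ i.2 n ∧ i.2 n < (T : ℤ)
  X_periodic : ∀ (m : Fin d) (i : Node d k), i.shift T m ∈ X ↔ i ∈ X
  E_subset : E ⊆ X ×ˢ X
  E_connected : ∀ i ∈ X, ∀ j ∈ X, Relation.ReflTransGen (fun p q => (p, q) ∈ E) i j
  E_periodic : ∀ (m : Fin d) (i j : Node d k), (i, j) ∈ E → (i.shift T m, j.shift T m) ∈ E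
  E_bounded : ∃ R : ℝ, ∀ i j : Node d k, (i, j) ∈ E → i.eucDist j ≤ R
  a_periodic : ∀ (m : Fin d), ∀ i ∈ X, ∀ j ∈ X, a (i.shift T m) (j.shift T m) = a i j
  a_pos : ∀ i j : Node d k, (i, j) ∈ E → 0 < a i j
  a_zero : ∀ i ∈ X, ∀ j ∈ X, (i, j) ∉ E → a i j = 0

/-- The point `ε l` of `ℝ^d`, for `l ∈ ℤ^d`. -/
noncomputable def latticePoint {d : ℕ} (ε : ℝ) (l : Fin d → ℤ) : EuclideanSpace ℝ (Fin d) :=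
  WithLp.toLp 2 (fun m => ε * (l m : ℝ))

/-- The half-open cube `ε (l T + [0, T)^d)`. -/
def scaledCube {d : ℕ} (ε : ℝ) (T : ℕ) (l : Fin d → ℤ) : Set (EuclideanSpace ℝ (Fin d)) :=
  {x | ∀ m, ε * ((T : ℝ) * l m) ≤ x m ∧ x m < ε * ((T : ℝ) * l m + T)}

/-- The average `⨍ u` over the cell `ε l + ε [0, 1)^d`. -/
noncomputable def cellAverage {d : ℕ} (ε : ℝ) (u : EuclideanSpace ℝ (Fin d) → ℝ)
    (l : Fin d → ℤ) : ℝ :=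
  ⨍ x in scaledCube ε 1 l, u x

/-- `A(δ)`: the points of `A` at distance more than `δ` from `∂A`. -/
def innerSet {d : ℕ} (A : Set (EuclideanSpace ℝ (Fin d))) (δ : ℝ) :
    Set (EuclideanSpace ℝ (Fin d)) :=
  {x ∈ A | δ < Metric.infDist x (frontier A)}

namespace PeriodicNetwork

variable {d k T : ℕ} (N : PeriodicNetwork d k T)

/-- The nodes of `X` over the block `l T + {0, …, T-1}^d`. -/
def block (l : Fin d → ℤ) : Set (Node d k) :=
  {i ∈ N.X | ∀ m, (T : ℤ) * l m ≤ i.1 m ∧ i.1 m < (T : ℤ) * l m + T}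

/-- The average of a function over the nodes of the block `l`
(all blocks have the same number of nodes as the block `0`). -/
noncomputable def blockMean (u : Node d k → ℝ) (l : Fin d → ℤ) : ℝ :=
  (∑ᶠ i ∈ N.block l, u i) / ((N.block 0).ncard : ℝ)

/-- The coarse-grained function: the piecewise-constant function on `ℝ^d` whose value on each
cube `ε (l T + [0, T)^d)` contained in `Ω` is the block mean of `u` (and `0` elsewhere). -/
noncomputable def coarse (Ω : Set (EuclideanSpace ℝ (Fin d))) (ε : ℝ) (u : Node d k → ℝ)
    (x : EuclideanSpace ℝ (Fin d)) : ℝ :=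
  ∑ᶠ l ∈ {l : Fin d → ℤ | scaledCube ε T l ⊆ Ω},
    (scaledCube ε T l).indicator (fun _ => N.blockMean u l) x

/-- Convergence of a family of discrete functions, `u ε i` being the value at the node `ε i`,
to `v`: the coarse-grained functions converge to `v` in `L²_loc(Ω)` as `ε → 0⁺`. -/
def ConvergesTo (Ω : Set (EuclideanSpace ℝ (Fin d))) (u : ℝ → Node d k → ℝ)
    (v : EuclideanSpace ℝ (Fin d) → ℝ) : Prop :=
  ∀ K : Set (EuclideanSpace ℝ (Fin d)), IsCompact K → K ⊆ Ω →
    Tendsto (fun ε => eLpNorm (fun x => N.coarse Ω ε (u ε) x - v x) 2 (volume.restrict K))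
      (𝓝[>] 0) (𝓝 0)

/-- The nodes `i ∈ X` with `ε i^d ∈ A`. -/
def nodesIn (ε : ℝ) (A : Set (EuclideanSpace ℝ (Fin d))) : Set (Node d k) :=
  {i ∈ N.X | latticePoint ε i.1 ∈ A}

/-- The energy localized on `A`:
`∑_{i, j ∈ X, ε i^d, ε j^d ∈ A} ε^d a_ij ((u_i - u_j) / ε)^2`
(a finite sum if `A` is bounded and `ε > 0`). -/
noncomputable def energy (ε : ℝ) (A : Set (EuclideanSpace ℝ (Fin d))) (u : Node d k → ℝ) : ℝ :=
  ∑ᶠ i ∈ N.nodesIn ε A, ∑ᶠ j ∈ N.nodesIn ε A, ε ^ d * N.a i j * ((u i - u j) / ε) ^ 2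

end PeriodicNetwork

/-- `u ∈ H¹(Ω)`: `u` and its first-order weak derivatives belong to `L²(Ω)`. -/
def MemH1 {d : ℕ} (Ω : Set (EuclideanSpace ℝ (Fin d))) (u : EuclideanSpace ℝ (Fin d) → ℝ) :
    Prop :=
  MemLp u 2 (volume.restrict Ω) ∧
  ∀ m : Fin d, ∃ g : EuclideanSpace ℝ (Fin d) → ℝ, MemLp g 2 (volume.restrict Ω) ∧
    ∀ φ : EuclideanSpace ℝ (Fin d) → ℝ, ContDiff ℝ ∞ φ → HasCompactSupport φ →
      tsupport φ ⊆ Ω →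
      ∫ x in Ω, u x * fderiv ℝ φ x (EuclideanSpace.single m 1) = - ∫ x in Ω, g x * φ x

/-- `Ω` has Lipschitz boundary: near each boundary point, `Ω` is, in a direction `ν`, the part of
space above the graph of a Lipschitz function of the variables orthogonal to `ν`. -/
def HasLipschitzBoundary {d : ℕ} (Ω : Set (EuclideanSpace ℝ (Fin d))) : Prop :=
  ∀ x ∈ frontier Ω, ∃ r > 0, ∃ ν : EuclideanSpace ℝ (Fin d), ‖ν‖ = 1 ∧
    ∃ (L : NNReal) (γ : ((Submodule.span ℝ {ν})ᗮ : Submodule ℝ (EuclideanSpace ℝ (Fin d))) → ℝ),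
      LipschitzWith L γ ∧
      Ω ∩ Metric.ball x r = {y ∈ Metric.ball x r |
        γ ((Submodule.span ℝ {ν})ᗮ.orthogonalProjectionOnto y) < inner ℝ ν y}

/-!
The competitor is an interpolation `w = v + φ (u_ε - v)` on the nodes in `A`, where `v` is the
family of cell averages of `u` and `φ` is a cut-off depending on the distance to `∂A`, equal to `0`
up to distance `δ` and to `1` from distance `2δ` on; at the nodes outside `A`, which carry no
energy, `w` is `v` (computed there from the extension by zero of `u` outside `Ω ∪ V`, where `V` is
the neighbourhood of the closure of `A` on which `u` is `H¹`).

For an edge `(i, j)` the increment `w_i - w_j` is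
`φ_i (u_i - u_j) + (1 - φ_i) (v_i - v_j) + (φ_i - φ_j) (u_j - v_j)`. The first two terms form a
convex combination, so Young's inequality with parameter `δ` bounds the energy of `w` by `1 + δ`
times the energy of `u_ε`, plus `1 + δ` times the energy of `v` on the strip
`{dist(·, ∂A) < 2δ}`, plus a coupling term (`PeriodicNetwork.dirichlet_interpolate_le`). Convexity
makes the usual selection of a good transition layer superfluous.

* The energy of `v` on the strip is at most a constant times `∫ |∇u|²` over the slightly larger
  strip `{dist(·, ∂A) < 3δ} ∩ V` (`PeriodicNetwork.sum_cellAverage_le`). This rests on the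
  difference quotient estimate for functions with weak derivatives in `L²`, obtained by testing
  against smooth functions (`IsWeakGradient.sq_cellAverage_sub_le`). The integral tends to `0`
  with `δ` because a Lipschitz boundary is a null set
  (`volume_frontier_of_hasLipschitzBoundary`).
* The coupling term is at most a constant depending on `δ` times `ε^d ∑ (u_j - v_j)²`, the sum
  being over the nodes in a compact subset of `A`, and this tends to `0` with `ε`
  (`PeriodicNetwork.tendsto_sum_sq_sub`): the block means of `u_ε` and `v` are close because both
  families converge to `u` (for `v`, see `PeriodicNetwork.convergesTo_cellAverage`), and the
  oscillation within a block is controlled by the energy, since any two nodes of a block are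
  joined by a path of edges and, up to periodicity, there are finitely many such paths
  (`PeriodicNetwork.exists_sum_sq_le_blockMean_add_dirichlet`).

The same limit shows that `w` and `v` have the same limit `u`.
-/

/-! ### Lattice points and cubes -/

theorem EuclideanSpace.dist_le_card_mul {d : ℕ} {c : ℝ} {x y : EuclideanSpace ℝ (Fin d)}
    (hc : 0 ≤ c) (h : ∀ m, |x m - y m| ≤ c) : dist x y ≤ d * c := by
  rw [EuclideanSpace.dist_eq]
  have h1 : ∑ m, dist (x m) (y m) ^ 2 ≤ (d * c) ^ 2 := by
    calc ∑ m, dist (x m) (y m) ^ 2 ≤ ∑ _m : Fin d, c ^ 2 := by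
          refine Finset.sum_le_sum fun m _ => ?_
          rw [Real.dist_eq]
          exact pow_le_pow_left₀ (abs_nonneg _) (h m) 2
      _ = d * c ^ 2 := by simp
      _ ≤ (d * c) ^ 2 := by
          rw [mul_pow]
          refine mul_le_mul_of_nonneg_right ?_ (sq_nonneg c)
          exact_mod_cast Nat.le_self_pow (by norm_num) d
  exact Real.sqrt_le_iff.2 ⟨by positivity, h1⟩

theorem EuclideanSpace.abs_sub_apply_le_dist {d : ℕ} (x y : EuclideanSpace ℝ (Fin d))
    (m : Fin d) : |x m - y m| ≤ dist x y := by
  rw [dist_eq_norm, ← Real.norm_eq_abs, ← PiLp.sub_apply]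
  exact PiLp.norm_apply_le (x - y) m

@[simp] theorem latticePoint_apply {d : ℕ} (ε : ℝ) (l : Fin d → ℤ) (m : Fin d) :
    latticePoint ε l m = ε * l m := rfl

theorem measurableSet_scaledCube {d : ℕ} (ε : ℝ) (T : ℕ) (l : Fin d → ℤ) :
    MeasurableSet (scaledCube ε T l) := by
  have h : scaledCube ε T l = ⋂ m, {x | ε * ((T : ℝ) * l m) ≤ x m} ∩
      {x | x m < ε * ((T : ℝ) * l m + T)} := by
    ext x
    simp [scaledCube]
  rw [h]
  refine MeasurableSet.iInter fun m => ?_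
  have hm : Measurable fun x : EuclideanSpace ℝ (Fin d) => x m := by fun_prop
  exact (measurableSet_le measurable_const hm).inter (measurableSet_lt hm measurable_const)

theorem volume_scaledCube {d : ℕ} {ε : ℝ} (hε : 0 ≤ ε) (T : ℕ) (l : Fin d → ℤ) :
    volume (scaledCube ε T l) = ENNReal.ofReal ((ε * T) ^ d) := by
  have h : scaledCube ε T l = (MeasurableEquiv.toLp 2 (Fin d → ℝ)).symm ⁻¹'
      (Set.univ.pi fun m => Set.Ico (ε * ((T : ℝ) * l m)) (ε * ((T : ℝ) * l m + T))) := by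
    ext x
    simp [scaledCube, Set.mem_pi]
  rw [h, (EuclideanSpace.volume_preserving_symm_measurableEquiv_toLp (Fin d)).measure_preimage
    (MeasurableSet.univ_pi fun _ => measurableSet_Ico).nullMeasurableSet, Real.volume_pi_Ico]
  have h2 : ∀ m : Fin d, ε * ((T : ℝ) * l m + T) - ε * ((T : ℝ) * l m) = ε * T := by
    intro m; ring
  simp only [h2, Finset.prod_const, Finset.card_univ, Fintype.card_fin]
  rw [ENNReal.ofReal_pow (by positivity)]

theorem convex_scaledCube {d : ℕ} (ε : ℝ) (T : ℕ) (l : Fin d → ℤ) :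
    Convex ℝ (scaledCube ε T l) := by
  have h : scaledCube ε T l = (WithLp.linearEquiv 2 ℝ (Fin d → ℝ)).toLinearMap ⁻¹'
      (Set.univ.pi fun m => Set.Ico (ε * ((T : ℝ) * l m)) (ε * ((T : ℝ) * l m + T))) := by
    ext x
    simp [scaledCube, Set.mem_pi]
  rw [h]
  exact (convex_pi fun _ _ => convex_Ico _ _).linear_preimage _

/-- The index of the half-open cube `ε (l T + [0, T)^d)` that contains `x`. -/
noncomputable def cubeIndex {d : ℕ} (ε : ℝ) (T : ℕ) (x : EuclideanSpace ℝ (Fin d)) : Fin d → ℤ :=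
  fun m => ⌊x m / (ε * T)⌋

theorem mem_scaledCube_iff {d T : ℕ} {ε : ℝ} (hε : 0 < ε) (hT : 1 ≤ T)
    {x : EuclideanSpace ℝ (Fin d)} {l : Fin d → ℤ} :
    x ∈ scaledCube ε T l ↔ cubeIndex ε T x = l := by
  have hT' : (0 : ℝ) < T := by exact_mod_cast hT
  have hp : 0 < ε * T := by positivity
  rw [funext_iff]
  refine forall_congr' fun m => ?_
  rw [cubeIndex, Int.floor_eq_iff, le_div_iff₀ hp, div_lt_iff₀ hp]
  have e1 : (l m : ℝ) * (ε * T) = ε * (T * l m) := by ring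
  have e2 : ((l m : ℝ) + 1) * (ε * T) = ε * (T * l m + T) := by ring
  rw [e1, e2]

theorem scaledCube_subset_closedBall {d T : ℕ} {ε : ℝ} (hε : 0 ≤ ε) {l : Fin d → ℤ}
    {y : EuclideanSpace ℝ (Fin d)} (hy : y ∈ scaledCube ε T l) :
    scaledCube ε T l ⊆ Metric.closedBall y (d * (ε * T)) := by
  intro x hx
  refine EuclideanSpace.dist_le_card_mul (by positivity) fun m => ?_
  have h1 := hx m
  have h2 := hy m
  rw [abs_le]
  constructor <;> nlinarith

theorem latticePoint_mem_scaledCube_one {d : ℕ} {ε : ℝ} (hε : 0 < ε) (l : Fin d → ℤ) :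
    latticePoint ε l ∈ scaledCube ε 1 l := by
  intro m
  simp only [latticePoint_apply, Nat.cast_one, one_mul, le_refl, true_and]
  nlinarith

theorem latticePoint_mem_scaledCube_iff {d T : ℕ} {ε : ℝ} (hε : 0 < ε) {i l : Fin d → ℤ} :
    latticePoint ε i ∈ scaledCube ε T l ↔ ∀ m, (T : ℤ) * l m ≤ i m ∧ i m < (T : ℤ) * l m + T := by
  refine forall_congr' fun m => ?_
  rw [latticePoint_apply, mul_le_mul_iff_right₀ hε, mul_lt_mul_iff_right₀ hε]
  norm_cast

/-- The unit cell of a node lies in the cube of the block of that node. -/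
theorem scaledCube_one_subset {d T : ℕ} {ε : ℝ} (hε : 0 < ε) {i l : Fin d → ℤ}
    (h : ∀ m, (T : ℤ) * l m ≤ i m ∧ i m < (T : ℤ) * l m + T) :
    scaledCube ε 1 i ⊆ scaledCube ε T l := by
  intro x hx m
  have h1 := hx m
  obtain ⟨h2, h3⟩ := h m
  have h2' : (T : ℝ) * l m ≤ i m := by exact_mod_cast h2
  have h3' : (i m : ℝ) + 1 ≤ (T : ℝ) * l m + T := by exact_mod_cast h3
  simp only [Nat.cast_one, one_mul] at h1
  exact ⟨le_trans (mul_le_mul_of_nonneg_left h2' hε.le) h1.1,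
    lt_of_lt_of_le h1.2 (mul_le_mul_of_nonneg_left h3' hε.le)⟩

/-! ### Nodes, blocks and translations -/

/-- The translation of a node by `T l`, for `l ∈ ℤ^d`. -/
def Node.translate {d k : ℕ} (T : ℕ) (l : Fin d → ℤ) (i : Node d k) : Node d k :=
  (i.1 + fun m => (T : ℤ) * l m, i.2)

theorem Node.translate_injective {d k : ℕ} (T : ℕ) (l : Fin d → ℤ) :
    Function.Injective (Node.translate T l : Node d k → Node d k) := by
  intro i j h
  simp only [Node.translate, Prod.mk.injEq, add_left_inj] at h
  exact Prod.ext h.1 h.2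

theorem Node.translate_left_injective {d k T : ℕ} (hT : 1 ≤ T) (i : Node d k) :
    Function.Injective fun l => Node.translate T l i := by
  intro l l' h
  simp only [Node.translate, Prod.mk.injEq, add_right_inj, and_true] at h
  funext m
  have h1 := congrFun h m
  have hT' : (T : ℤ) ≠ 0 := by positivity
  exact mul_left_cancel₀ hT' h1

theorem Node.eucDist_translate {d k : ℕ} (T : ℕ) (l : Fin d → ℤ) (i j : Node d k) :
    (i.translate T l).eucDist (j.translate T l) = i.eucDist j := by
  simp [Node.eucDist, Node.translate]

theorem dist_latticePoint_le {d k : ℕ} {ε : ℝ} (hε : 0 ≤ ε) (i j : Node d k) :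
    dist (latticePoint ε i.1) (latticePoint ε j.1) ≤ ε * i.eucDist j := by
  rw [EuclideanSpace.dist_eq, Node.eucDist, ← Real.sqrt_sq hε, ← Real.sqrt_mul (sq_nonneg _),
    Real.sqrt_sq hε]
  refine Real.sqrt_le_sqrt ?_
  rw [mul_add, Finset.mul_sum]
  refine le_add_of_le_of_nonneg (Finset.sum_le_sum fun m _ => le_of_eq ?_) (by positivity)
  rw [Real.dist_eq, sq_abs]
  simp only [latticePoint_apply]
  ring

/-- An invariance under the unit translations is an invariance under all translations. -/
theorem iff_zero_of_forall_single {ι : Type*} [Fintype ι] [DecidableEq ι] {P : (ι → ℤ) → Prop}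
    (h : ∀ l m, P (l + Pi.single m 1) ↔ P l) (l : ι → ℤ) : P l ↔ P 0 := by
  let H : AddSubgroup (ι → ℤ) :=
    { carrier := {c | ∀ l, P (l + c) ↔ P l}
      zero_mem' := by simp
      add_mem' := by
        intro a b ha hb l
        rw [← add_assoc, hb, ha]
      neg_mem' := by
        intro a ha l
        rw [← ha (l + -a), neg_add_cancel_right] }
  have hl : l ∈ H := by
    rw [← Finset.univ_sum_single l]
    refine H.sum_mem fun m _ => ?_
    have : (Pi.single m (l m) : ι → ℤ) = l m • Pi.single m 1 := by
      rw [← Pi.single_smul]; simp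
    rw [this]
    exact H.zsmul_mem (fun l => h l m) _
  simpa using hl 0

theorem Node.shift_translate {d k : ℕ} (T : ℕ) (l : Fin d → ℤ) (m : Fin d) (i : Node d k) :
    Node.translate T (l + Pi.single m 1) i = (i.translate T l).shift T m := by
  refine Prod.ext ?_ rfl
  funext n
  by_cases h : n = m
  · subst h; simp [Node.translate, Node.shift]; ring
  · simp [Node.translate, Node.shift, h]

@[simp] theorem Node.translate_zero {d k : ℕ} (T : ℕ) (i : Node d k) :
    Node.translate T 0 i = i := by
  refine Prod.ext ?_ rfl
  funext n
  simp [Node.translate]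

namespace PeriodicNetwork

variable {d k T : ℕ} (N : PeriodicNetwork d k T)

theorem translate_mem_X_iff (l : Fin d → ℤ) {i : Node d k} : i.translate T l ∈ N.X ↔ i ∈ N.X := by
  have := iff_zero_of_forall_single (P := fun l => i.translate T l ∈ N.X)
    (fun l m => by rw [Node.shift_translate, N.X_periodic]) l
  simpa using this

theorem a_translate (l : Fin d → ℤ) {i j : Node d k} (hi : i ∈ N.X) (hj : j ∈ N.X) :
    N.a (i.translate T l) (j.translate T l) = N.a i j := by
  have := iff_zero_of_forall_single
    (P := fun l => N.a (i.translate T l) (j.translate T l) = N.a i j)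
    (fun l m => by
      rw [Node.shift_translate, Node.shift_translate, N.a_periodic _ _
        ((N.translate_mem_X_iff l).2 hi) _ ((N.translate_mem_X_iff l).2 hj)]) l
  simpa using this

theorem a_nonneg {i j : Node d k} (hi : i ∈ N.X) (hj : j ∈ N.X) : 0 ≤ N.a i j := by
  by_cases h : (i, j) ∈ N.E
  · exact (N.a_pos i j h).le
  · exact (N.a_zero i hi j hj h).ge

theorem mem_block_iff {l : Fin d → ℤ} {i : Node d k} :
    i ∈ N.block l ↔ i ∈ N.X ∧ ∀ m, (T : ℤ) * l m ≤ i.1 m ∧ i.1 m < (T : ℤ) * l m + T := Iff.rfl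

theorem translate_mem_block_iff {l : Fin d → ℤ} {i : Node d k} :
    i.translate T l ∈ N.block l ↔ i ∈ N.block 0 := by
  rw [mem_block_iff, mem_block_iff, N.translate_mem_X_iff]
  refine and_congr_right fun _ => forall_congr' fun m => ?_
  simp only [Node.translate, Pi.add_apply, Pi.zero_apply, mul_zero, zero_add]
  constructor <;> rintro ⟨h1, h2⟩ <;> constructor <;> linarith

theorem block_eq_image (l : Fin d → ℤ) : N.block l = Node.translate T l '' N.block 0 := by
  ext i
  constructor
  · intro hi
    have e : Node.translate T l (i.1 - fun m => (T : ℤ) * l m, i.2) = i :=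
      Prod.ext (by simp [Node.translate]) rfl
    refine ⟨_, ?_, e⟩
    rw [← N.translate_mem_block_iff (l := l), e]
    exact hi
  · rintro ⟨p, hp, rfl⟩
    exact N.translate_mem_block_iff.2 hp

theorem exists_mem_block (hT : 1 ≤ T) {i : Node d k} (hi : i ∈ N.X) : ∃ l, i ∈ N.block l := by
  have hT' : (0 : ℤ) < T := by exact_mod_cast hT
  refine ⟨fun m => i.1 m / T, hi, fun m => ⟨Int.mul_ediv_self_le hT'.ne', ?_⟩⟩
  exact Int.lt_mul_ediv_self_add hT'

/-- The nodes of `X` whose first component is within `r`, in each coordinate, of a given point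
of `ℝ^d` form a finite set whose cardinality is bounded independently of that point. -/
theorem exists_card_near_le (r : ℝ) : ∃ M : ℕ, ∀ y : Fin d → ℝ,
    {i ∈ N.X | ∀ m, |(i.1 m : ℝ) - y m| ≤ r}.Finite ∧
    {i ∈ N.X | ∀ m, |(i.1 m : ℝ) - y m| ≤ r}.ncard ≤ M := by
  let n : ℤ := ⌈r⌉ + 1
  refine ⟨(Fintype.piFinset fun _ : Fin d => Finset.Icc (-n) n).card *
    (Fintype.piFinset fun _ : Fin k => Finset.Ico (0 : ℤ) T).card, fun y => ?_⟩
  let S : Finset (Node d k) :=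
    (Fintype.piFinset fun m : Fin d => Finset.Icc (⌊y m⌋ - n) (⌊y m⌋ + n)) ×ˢ
    (Fintype.piFinset fun _ : Fin k => Finset.Ico (0 : ℤ) T)
  have hsub : {i ∈ N.X | ∀ m, |(i.1 m : ℝ) - y m| ≤ r} ⊆ (S : Set (Node d k)) := by
    rintro i ⟨hi, him⟩
    simp only [S, Finset.coe_product, Set.mem_prod, Finset.mem_coe, Fintype.mem_piFinset,
      Finset.mem_Icc, Finset.mem_Ico]
    refine ⟨fun m => ?_, fun m => N.X_thin i hi m⟩
    have h1 := abs_le.1 (him m)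
    have h2 := Int.floor_le (y m)
    have h3 := Int.lt_floor_add_one (y m)
    have h4 := Int.le_ceil r
    constructor
    · have : ((⌊y m⌋ - n : ℤ) : ℝ) ≤ i.1 m := by simp only [n]; push_cast; linarith
      exact_mod_cast this
    · have : (i.1 m : ℝ) ≤ ((⌊y m⌋ + n : ℤ) : ℝ) := by simp only [n]; push_cast; linarith
      exact_mod_cast this
  refine ⟨S.finite_toSet.subset hsub, ?_⟩
  refine (Set.ncard_le_ncard hsub S.finite_toSet).trans ?_
  rw [Set.ncard_coe_finset]
  simp only [S, Finset.card_product, Fintype.card_piFinset, Int.card_Icc]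
  refine le_of_eq ?_
  congr 1
  refine Finset.prod_congr rfl fun m _ => ?_
  congr 1
  ring

theorem block_finite (l : Fin d → ℤ) : (N.block l).Finite := by
  obtain ⟨M, hM⟩ := N.exists_card_near_le T
  refine (hM fun m => (T : ℝ) * l m).1.subset ?_
  rintro i ⟨hi, him⟩
  refine ⟨hi, fun m => ?_⟩
  obtain ⟨h1, h2⟩ := him m
  have h1' : (T : ℝ) * l m ≤ i.1 m := by exact_mod_cast h1
  have h2' : (i.1 m : ℝ) < (T : ℝ) * l m + T := by exact_mod_cast h2
  rw [abs_le]
  constructor <;> linarith [(Nat.cast_nonneg T : (0 : ℝ) ≤ T)]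

/-- The nodes of the block `0`, as a finite set. -/
noncomputable def cell : Finset (Node d k) := (N.block_finite 0).toFinset

@[simp] theorem mem_cell {p : Node d k} : p ∈ N.cell ↔ p ∈ N.block 0 := by simp [cell]

theorem cell_card_pos (hT : 1 ≤ T) (hX : N.X.Nonempty) : 0 < N.cell.card := by
  obtain ⟨i, hi⟩ := hX
  obtain ⟨l, hl⟩ := N.exists_mem_block hT hi
  rw [block_eq_image] at hl
  obtain ⟨p, hp, -⟩ := hl
  exact Finset.card_pos.2 ⟨p, N.mem_cell.2 hp⟩

theorem blockMean_eq (u : Node d k → ℝ) (l : Fin d → ℤ) :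
    N.blockMean u l = (∑ p ∈ N.cell, u (p.translate T l)) / N.cell.card := by
  rw [blockMean, block_eq_image, finsum_mem_image (Node.translate_injective T l).injOn, cell,
    finsum_mem_eq_finite_toFinset_sum _ (N.block_finite 0),
    Set.ncard_eq_toFinset_card _ (N.block_finite 0)]

theorem blockMean_sub (u v : Node d k → ℝ) (l : Fin d → ℤ) :
    N.blockMean (fun i => u i - v i) l = N.blockMean u l - N.blockMean v l := by
  simp only [blockMean_eq, Finset.sum_sub_distrib, sub_div]

/-- The square of a block mean is at most the mean of the squares. -/
theorem sq_blockMean_le (hb : 0 < N.cell.card) (u : Node d k → ℝ) (l : Fin d → ℤ) :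
    N.blockMean u l ^ 2 ≤ (∑ p ∈ N.cell, u (p.translate T l) ^ 2) / N.cell.card := by
  have hb' : (0 : ℝ) < N.cell.card := by exact_mod_cast hb
  rw [blockMean_eq, div_pow, div_le_div_iff₀ (by positivity) hb']
  have := sq_sum_le_card_mul_sum_sq (s := N.cell) (f := fun p => u (p.translate T l))
  nlinarith

theorem nodesIn_finite {ε : ℝ} (hε : 0 < ε) {A : Set (EuclideanSpace ℝ (Fin d))}
    (hA : Bornology.IsBounded A) : (N.nodesIn ε A).Finite := by
  obtain ⟨r, hr⟩ := hA.subset_closedBall 0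
  obtain ⟨M, hM⟩ := N.exists_card_near_le (r / ε)
  refine (hM 0).1.subset ?_
  rintro i ⟨hi, hiA⟩
  refine ⟨hi, fun m => ?_⟩
  have h1 := (EuclideanSpace.abs_sub_apply_le_dist _ _ m).trans (hr hiA)
  rw [latticePoint_apply, PiLp.zero_apply, sub_zero, abs_mul, abs_of_pos hε] at h1
  rw [Pi.zero_apply, sub_zero, le_div_iff₀ hε]
  linarith

/-- A radius `R > 0` that bounds the range of the interactions. -/
theorem exists_range : ∃ R : ℝ, 0 < R ∧ ∀ i j : Node d k, (i, j) ∈ N.E → i.eucDist j ≤ R := by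
  obtain ⟨R, hR⟩ := N.E_bounded
  exact ⟨max R 1, by positivity, fun i j h => (hR i j h).trans (le_max_left _ _)⟩

theorem abs_sub_le_eucDist (i j : Node d k) (m : Fin d) :
    |(i.1 m : ℝ) - j.1 m| ≤ i.eucDist j := by
  rw [← Real.sqrt_sq_eq_abs, Node.eucDist]
  refine Real.sqrt_le_sqrt ?_
  refine le_add_of_le_of_nonneg ?_ (by positivity)
  exact Finset.single_le_sum (f := fun m => ((i.1 m : ℝ) - j.1 m) ^ 2)
    (fun _ _ => sq_nonneg _) (Finset.mem_univ m)

/-- By periodicity there are finitely many coefficients up to translation, hence an upper bound. -/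
theorem exists_a_le (hT : 1 ≤ T) : ∃ K : ℝ, 0 < K ∧ ∀ i ∈ N.X, ∀ j ∈ N.X, N.a i j ≤ K := by
  obtain ⟨R, hR, hE⟩ := N.exists_range
  obtain ⟨M, hM⟩ := N.exists_card_near_le (R + T)
  have hfin := ((N.block_finite 0).prod (hM 0).1).image fun e => N.a e.1 e.2
  obtain ⟨K, hK⟩ := hfin.bddAbove
  refine ⟨max K 1, by positivity, fun i hi j hj => ?_⟩
  by_cases h : (i, j) ∈ N.E
  swap
  · rw [N.a_zero i hi j hj h]; positivity
  refine le_trans ?_ (le_max_left _ _)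
  obtain ⟨l, hl⟩ := N.exists_mem_block hT hi
  rw [block_eq_image] at hl
  obtain ⟨p, hp, rfl⟩ := hl
  have e : Node.translate T l (j.1 - fun m => (T : ℤ) * l m, j.2) = j :=
    Prod.ext (by simp [Node.translate]) rfl
  generalize ((j.1 - fun m => (T : ℤ) * l m, j.2) : Node d k) = q at e
  subst e
  rw [N.translate_mem_X_iff] at hi hj
  rw [N.a_translate l hi hj]
  have hd := hE _ _ h
  rw [Node.eucDist_translate] at hd
  refine hK ⟨(p, q), ⟨hp, hj, fun m => ?_⟩, rfl⟩
  have h1 := (abs_sub_le_eucDist p q m).trans hd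
  obtain ⟨h2, h3⟩ := hp.2 m
  simp only [Pi.zero_apply, mul_zero, zero_add] at h2 h3
  have h2' : (0 : ℝ) ≤ p.1 m := by exact_mod_cast h2
  have h3' : (p.1 m : ℝ) < T := by exact_mod_cast h3
  rw [abs_le] at h1 ⊢
  simp only [Pi.zero_apply, sub_zero]
  constructor <;> linarith

end PeriodicNetwork

/-! ### Difference quotients of functions with weak derivatives -/

/-- The Cauchy–Schwarz inequality for two functions in `L²`. -/
theorem sq_integral_mul_le {α : Type*} [MeasurableSpace α] {μ : Measure α} {f g : α → ℝ}
    (hf : MemLp f 2 μ) (hg : MemLp g 2 μ) :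
    (∫ x, f x * g x ∂μ) ^ 2 ≤ (∫ x, f x ^ 2 ∂μ) * ∫ x, g x ^ 2 ∂μ := by
  have hfg : Integrable (fun x => f x * g x) μ := hf.integrable_mul hg
  have h : ∀ t : ℝ, 0 ≤ (∫ x, g x ^ 2 ∂μ) * (t * t) + (2 * ∫ x, f x * g x ∂μ) * t
      + ∫ x, f x ^ 2 ∂μ := by
    intro t
    have e : (∫ x, g x ^ 2 ∂μ) * (t * t) + (2 * ∫ x, f x * g x ∂μ) * t + ∫ x, f x ^ 2 ∂μ
        = ∫ x, (f x + t * g x) ^ 2 ∂μ := by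
      have e1 : ∀ x, (f x + t * g x) ^ 2
          = (t * t) * g x ^ 2 + (2 * t) * (f x * g x) + f x ^ 2 := fun x => by ring
      simp only [e1]
      have i1 := hg.integrable_sq.const_mul (t * t)
      have i2 := hfg.const_mul (2 * t)
      have a1 := integral_add (i1.add i2) hf.integrable_sq
      have a2 := integral_add i1 i2
      simp only [Pi.add_apply] at a1
      rw [a1, a2, integral_const_mul, integral_const_mul]
      ring
    rw [e]
    exact integral_nonneg fun x => sq_nonneg _
  have := discrim_le_zero h
  rw [discrim] at this
  nlinarith

/-- The functions `g m` are the weak partial derivatives of `u` on `V`, and `u` and `g m` belong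
to `L²(V)`. -/
structure IsWeakGradient {d : ℕ} (V : Set (EuclideanSpace ℝ (Fin d)))
    (u : EuclideanSpace ℝ (Fin d) → ℝ) (g : Fin d → EuclideanSpace ℝ (Fin d) → ℝ) : Prop where
  memLp : MemLp u 2 (volume.restrict V)
  memLp_grad : ∀ m, MemLp (g m) 2 (volume.restrict V)
  integral_eq : ∀ m, ∀ φ : EuclideanSpace ℝ (Fin d) → ℝ, ContDiff ℝ ∞ φ → HasCompactSupport φ →
      tsupport φ ⊆ V →
      ∫ x in V, u x * fderiv ℝ φ x (EuclideanSpace.single m 1) = - ∫ x in V, g m x * φ x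

theorem MemH1.exists_isWeakGradient {d : ℕ} {V : Set (EuclideanSpace ℝ (Fin d))}
    {u : EuclideanSpace ℝ (Fin d) → ℝ} (h : MemH1 V u) : ∃ g, IsWeakGradient V u g := by
  choose g hg hg' using h.2
  exact ⟨g, h.1, hg, hg'⟩

section

variable {d : ℕ}

theorem hasDerivAt_integral_mul_translate {f φ : EuclideanSpace ℝ (Fin d) → ℝ}
    (hf : LocallyIntegrable f) (hφ : ContDiff ℝ ∞ φ) (hφc : HasCompactSupport φ)
    (h : EuclideanSpace ℝ (Fin d)) (s : ℝ) :
    HasDerivAt (fun s : ℝ => ∫ y, f y * φ (y - s • h))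
      (-∫ y, f y * fderiv ℝ φ (y - s • h) h) s := by
  set ψ : EuclideanSpace ℝ (Fin d) → ℝ := fun z => φ (-z) with hψ
  have hψd : ContDiff ℝ 1 ψ := (hφ.of_le (by exact_mod_cast le_top)).comp contDiff_neg
  have hψc : HasCompactSupport ψ := hφc.comp_homeomorph (Homeomorph.neg _)
  have key := (hψc.hasFDerivAt_convolution_right (ContinuousLinearMap.mul ℝ ℝ) hf hψd
    (s • h)).comp_hasDerivAt s ((hasDerivAt_id s).smul_const h)
  simp only [id, one_smul] at key
  rw [convolution_precompR_apply _ hf (hψc.fderiv ℝ) (hψd.continuous_fderiv one_ne_zero)] at key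
  have e1 : (convolution f ψ (ContinuousLinearMap.mul ℝ ℝ) volume ∘ fun y : ℝ => y • h)
      = fun s : ℝ => ∫ y, f y * φ (y - s • h) := by
    funext s
    simp [convolution, hψ]
  have hfd : ∀ z, fderiv ℝ ψ z h = - fderiv ℝ φ (-z) h := by
    intro z
    have h1 : HasFDerivAt φ (fderiv ℝ φ (-z)) (-z) :=
      ((hφ.differentiable (by simp)) (-z)).hasFDerivAt
    have h2 := h1.comp z (hasFDerivAt_id z).neg
    have h3 : fderiv ℝ ψ z = _ := h2.fderiv
    rw [h3]
    simp
  have e2 : convolution f (fun a => fderiv ℝ ψ a h) (ContinuousLinearMap.mul ℝ ℝ) volume (s • h)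
      = -∫ y, f y * fderiv ℝ φ (y - s • h) h := by
    rw [← integral_neg]
    simp [convolution, hfd]
  rw [e2] at key
  rw [e1] at key
  exact key

/-- The difference quotient estimate, tested against a smooth function: the translates of the
support of `φ` by the multiples `s h`, `s ∈ [0, 1]`, have to stay in `W ⊆ V`. -/
theorem IsWeakGradient.sq_integral_translate_sub_le {V W : Set (EuclideanSpace ℝ (Fin d))}
    {u : EuclideanSpace ℝ (Fin d) → ℝ} {g : Fin d → EuclideanSpace ℝ (Fin d) → ℝ}
    (hu : IsWeakGradient V u g) (hV : MeasurableSet V) (hWV : W ⊆ V)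
    {φ : EuclideanSpace ℝ (Fin d) → ℝ} (hφ : ContDiff ℝ ∞ φ) (hφc : HasCompactSupport φ)
    {h : EuclideanSpace ℝ (Fin d)}
    (hsupp : ∀ x ∈ tsupport φ, ∀ s ∈ Icc (0 : ℝ) 1, x + s • h ∈ W) :
    (∫ x, (V.indicator u (x + h) - V.indicator u x) * φ x) ^ 2
      ≤ ‖h‖ ^ 2 * (∫ x in W, ∑ m, g m x ^ 2) * ∫ x, φ x ^ 2 := by
  set f := V.indicator u with hf_def
  have hf : MemLp f 2 volume := (memLp_indicator_iff_restrict hV).2 hu.memLp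
  have hfl : LocallyIntegrable f := hf.locallyIntegrable (by norm_num)
  have hφL : MemLp φ 2 volume := hφ.continuous.memLp_of_hasCompactSupport hφc
  set G := ∫ x in W, ∑ m, g m x ^ 2 with hG
  have hG0 : 0 ≤ G := integral_nonneg fun x => Finset.sum_nonneg fun m _ => sq_nonneg _
  set I := ∫ x, φ x ^ 2 with hI
  have hI0 : 0 ≤ I := integral_nonneg fun x => sq_nonneg _
  -- the derivative along the segment is controlled by the weak gradient on `W`
  have hbound : ∀ s ∈ Ico (0 : ℝ) 1,
      ‖-∫ y, f y * fderiv ℝ φ (y - s • h) h‖ ≤ Real.sqrt (‖h‖ ^ 2 * G * I) := by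
    intro s hs
    set ψ : EuclideanSpace ℝ (Fin d) → ℝ := fun y => φ (y - s • h) with hψ
    have hψd : ContDiff ℝ ∞ ψ := hφ.comp (contDiff_id.sub contDiff_const)
    have hts : tsupport ψ = (Homeomorph.subRight (s • h)) ⁻¹' tsupport φ :=
      tsupport_comp_eq_preimage φ (Homeomorph.subRight (s • h))
    have hψc : HasCompactSupport ψ := hφc.comp_homeomorph (Homeomorph.subRight (s • h))
    have hψW : tsupport ψ ⊆ W := by
      intro y hy
      rw [hts] at hy
      have := hsupp _ hy s ⟨hs.1, hs.2.le⟩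
      simpa using this
    have hψL : MemLp ψ 2 volume := hψd.continuous.memLp_of_hasCompactSupport hψc
    have hfd : ∀ y v, fderiv ℝ ψ y v = fderiv ℝ φ (y - s • h) v := by
      intro y v
      rw [hψ, fderiv_comp_sub]
    have hexp : ∀ y, fderiv ℝ φ (y - s • h) h
        = ∑ m, h m * fderiv ℝ ψ y (EuclideanSpace.single m 1) := by
      intro y
      rw [← hfd]
      have hsum : h = ∑ m, EuclideanSpace.single m (h m) := by
        ext n
        simp [Pi.single_apply]
      conv_lhs => rw [hsum]
      rw [map_sum]
      refine Finset.sum_congr rfl fun m _ => ?_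
      have : (EuclideanSpace.single m (h m) : EuclideanSpace ℝ (Fin d))
          = h m • EuclideanSpace.single m 1 := by
        ext n
        simp
      rw [this, map_smul, smul_eq_mul]
    have hint : ∀ m, IntegrableOn (fun y => u y * fderiv ℝ ψ y (EuclideanSpace.single m 1)) V := by
      intro m
      have hc : Continuous fun y => fderiv ℝ ψ y (EuclideanSpace.single m 1) :=
        (hψd.continuous_fderiv (by simp)).clm_apply continuous_const
      have hL : MemLp (fun y => fderiv ℝ ψ y (EuclideanSpace.single m 1)) 2 volume :=
        hc.memLp_of_hasCompactSupport (hψc.fderiv_apply ℝ _)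
      exact hu.memLp.integrable_mul (hL.restrict V)
    have hint2 : ∀ m, IntegrableOn (fun y => g m y * ψ y) V := fun m =>
      (hu.memLp_grad m).integrable_mul (hψL.restrict V)
    have e1 : -∫ y, f y * fderiv ℝ φ (y - s • h) h = ∫ y in W, (∑ m, h m * g m y) * ψ y := by
      have a1 : ∫ y, f y * fderiv ℝ φ (y - s • h) h
          = ∫ y in V, u y * fderiv ℝ φ (y - s • h) h := by
        rw [← integral_indicator hV]
        congr 1
        funext y
        by_cases hy : y ∈ V <;> simp [hf_def, hy]
      have a2 : ∫ y in V, (∑ m, h m * g m y) * ψ y = ∫ y in W, (∑ m, h m * g m y) * ψ y := by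
        refine setIntegral_eq_of_subset_of_forall_sdiff_eq_zero hV hWV fun y hy => ?_
        have : ψ y = 0 := image_eq_zero_of_notMem_tsupport fun hy' => hy.2 (hψW hy')
        rw [this, mul_zero]
      rw [a1, ← a2]
      simp only [hexp, Finset.mul_sum, Finset.sum_mul]
      rw [integral_finsetSum, integral_finsetSum, ← Finset.sum_neg_distrib]
      · refine Finset.sum_congr rfl fun m _ => ?_
        have b1 : ∀ y, u y * (h m * fderiv ℝ ψ y (EuclideanSpace.single m 1))
            = h m * (u y * fderiv ℝ ψ y (EuclideanSpace.single m 1)) := fun y => by ring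
        have b2 : ∀ y, h m * g m y * ψ y = h m * (g m y * ψ y) := fun y => by ring
        simp only [b1, b2, integral_const_mul]
        rw [hu.integral_eq m ψ hψd hψc (hψW.trans hWV)]
        ring
      · intro m _
        refine ((hint2 m).const_mul (h m)).congr (Eventually.of_forall fun y => ?_)
        simp only; ring
      · intro m _
        refine ((hint m).const_mul (h m)).congr (Eventually.of_forall fun y => ?_)
        simp only; ring
    rw [e1, Real.norm_eq_abs]
    refine Real.abs_le_sqrt ?_
    have hgW : ∀ m, MemLp (g m) 2 (volume.restrict W) := fun m =>
      (hu.memLp_grad m).mono_measure (Measure.restrict_mono hWV le_rfl)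
    have hsumL : MemLp (fun y => ∑ m, h m * g m y) 2 (volume.restrict W) :=
      memLp_finsetSum _ fun m _ => (hgW m).const_mul (h m)
    refine (sq_integral_mul_le hsumL (hψL.restrict W)).trans ?_
    have c1 : ∫ y in W, (∑ m, h m * g m y) ^ 2 ≤ ‖h‖ ^ 2 * G := by
      rw [hG, ← integral_const_mul]
      refine integral_mono hsumL.integrable_sq
        ((integrable_finsetSum _ fun m _ => (hgW m).integrable_sq).const_mul _) fun y => ?_
      rw [EuclideanSpace.norm_sq_eq]
      simp only [Real.norm_eq_abs, sq_abs]
      exact Finset.sum_mul_sq_le_sq_mul_sq _ _ _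
    have c2 : ∫ y in W, ψ y ^ 2 ≤ I := by
      refine (setIntegral_le_integral hψL.integrable_sq
        (Eventually.of_forall fun y => sq_nonneg _)).trans (le_of_eq ?_)
      exact integral_sub_right_eq_self (fun y => φ y ^ 2) (s • h)
    exact mul_le_mul c1 c2 (integral_nonneg fun y => sq_nonneg _) (by positivity)
  have hmv := norm_image_sub_le_of_norm_deriv_le_segment_01'
    (fun s _ => (hasDerivAt_integral_mul_translate hfl hφ hφc h s).hasDerivWithinAt) hbound
  have e0 : (∫ x, (f (x + h) - f x) * φ x)
      = (∫ y, f y * φ (y - (1 : ℝ) • h)) - ∫ y, f y * φ (y - (0 : ℝ) • h) := by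
    have i1 : Integrable fun x => f (x + h) * φ x :=
      (hf.comp_measurePreserving (measurePreserving_add_right volume h)).integrable_mul hφL
    have i2 : Integrable fun x => f x * φ x := hf.integrable_mul hφL
    simp only [sub_mul]
    rw [integral_sub i1 i2]
    congr 1
    · rw [← integral_add_right_eq_self (fun y => f y * φ (y - (1 : ℝ) • h)) h]
      simp
    · simp
  rw [e0, ← sq_abs, ← Real.norm_eq_abs]
  refine (pow_le_pow_left₀ (norm_nonneg _) hmv 2).trans (le_of_eq ?_)
  exact Real.sq_sqrt (by positivity)

/-- The difference quotient estimate on a bounded convex set, obtained by exhausting its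
indicator function by smooth functions. -/
theorem IsWeakGradient.sq_setIntegral_translate_sub_le {V W C : Set (EuclideanSpace ℝ (Fin d))}
    {u : EuclideanSpace ℝ (Fin d) → ℝ} {g : Fin d → EuclideanSpace ℝ (Fin d) → ℝ}
    (hu : IsWeakGradient V u g) (hV : MeasurableSet V) (hWV : W ⊆ V)
    (hC : Convex ℝ C) (hCb : Bornology.IsBounded C)
    {h : EuclideanSpace ℝ (Fin d)}
    (hsupp : ∀ x ∈ closure C, ∀ s ∈ Icc (0 : ℝ) 1, x + s • h ∈ W) :
    (∫ x in C, (V.indicator u (x + h) - V.indicator u x)) ^ 2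
      ≤ ‖h‖ ^ 2 * (∫ x in W, ∑ m, g m x ^ 2) * volume.real C := by
  set f := V.indicator u with hf_def
  have hf : MemLp f 2 volume := (memLp_indicator_iff_restrict hV).2 hu.memLp
  set D := fun x => f (x + h) - f x with hD
  have hDL : MemLp D 2 volume :=
    (hf.comp_measurePreserving (measurePreserving_add_right volume h)).sub hf
  have hInt : interior C =ᵐ[volume] C := by
    refine (ae_eq_set.2 ⟨?_, ?_⟩)
    · rw [sdiff_eq_empty.2 interior_subset, measure_empty]
    · exact measure_mono_null (sdiff_subset_sdiff_left subset_closure) (hC.addHaar_frontier volume)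
  have hfinC : volume (interior C) ≠ ⊤ :=
    ((hCb.subset interior_subset).measure_lt_top).ne
  obtain ⟨η, hη, hηd, hη01⟩ :=
    (isOpen_interior (s := C)).exists_contDiff_support_eq (n := ⊤)
  -- the smooth functions `φ n` increase to the indicator function of the interior of `C`
  let φ : ℕ → EuclideanSpace ℝ (Fin d) → ℝ := fun n x => Real.smoothTransition (n * η x)
  have hφd : ∀ n, ContDiff ℝ ∞ (φ n) := fun n =>
    Real.smoothTransition.contDiff.comp (contDiff_const.mul hηd)
  have hφ0 : ∀ n x, x ∉ interior C → φ n x = 0 := by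
    intro n x hx
    have : η x = 0 := by
      rw [← hη] at hx
      simpa using hx
    simp only [φ, this, mul_zero]
    exact Real.smoothTransition.zero
  have hφle : ∀ n x, ‖φ n x‖ ≤ 1 := fun n x => by
    rw [Real.norm_of_nonneg (Real.smoothTransition.nonneg _)]
    exact Real.smoothTransition.le_one _
  have hφs : ∀ n, tsupport (φ n) ⊆ closure C := fun n =>
    closure_mono fun x hx => interior_subset (by_contra fun h' => hx (hφ0 n x h'))
  have hφc : ∀ n, HasCompactSupport (φ n) := fun n =>
    hCb.isCompact_closure.of_isClosed_subset (isClosed_tsupport _) (hφs n)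
  have hφt : ∀ x ∈ interior C, ∀ᶠ n in atTop, φ n x = 1 := by
    intro x hx
    have hpos : 0 < η x := by
      have h1 : x ∈ Function.support η := by rw [hη]; exact hx
      exact lt_of_le_of_ne (hη01 (mem_range_self x)).1 (Ne.symm h1)
    filter_upwards [(tendsto_natCast_atTop_atTop (R := ℝ)).eventually_ge_atTop (η x)⁻¹] with n hn
    refine Real.smoothTransition.one_of_one_le ?_
    rwa [← inv_le_iff_one_le_mul₀ hpos]
  have hlim : Tendsto (fun n => ∫ x, D x * φ n x) atTop (𝓝 (∫ x in C, D x)) := by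
    rw [← setIntegral_congr_set hInt, ← integral_indicator isOpen_interior.measurableSet]
    refine tendsto_integral_of_dominated_convergence (fun x => ‖(interior C).indicator D x‖)
      (fun n => (hDL.1.mul (hφd n).continuous.aestronglyMeasurable)) ?_ ?_ ?_
    · refine Integrable.norm ((integrable_indicator_iff isOpen_interior.measurableSet).2 ?_)
      have : IsFiniteMeasure (volume.restrict (interior C)) :=
        ⟨by rw [Measure.restrict_apply_univ]; exact hfinC.lt_top⟩
      exact (hDL.restrict _).integrable (by norm_num)
    · intro n
      refine Eventually.of_forall fun x => ?_
      by_cases hx : x ∈ interior C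
      · rw [indicator_of_mem hx, norm_mul]
        exact mul_le_of_le_one_right (norm_nonneg _) (hφle n x)
      · rw [hφ0 n x hx, mul_zero, norm_zero]; exact norm_nonneg _
    · refine Eventually.of_forall fun x => ?_
      by_cases hx : x ∈ interior C
      · rw [indicator_of_mem hx]
        refine tendsto_const_nhds.congr' ?_
        filter_upwards [hφt x hx] with n hn
        rw [hn, mul_one]
      · rw [indicator_of_notMem hx]
        simp [hφ0 _ x hx]
  refine le_of_tendsto (hlim.pow 2) (Eventually.of_forall fun n => ?_)
  refine (hu.sq_integral_translate_sub_le hV hWV (hφd n) (hφc n)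
    (fun x hx => hsupp x (hφs n hx))).trans ?_
  refine mul_le_mul_of_nonneg_left ?_ (mul_nonneg (sq_nonneg _)
    (integral_nonneg fun x => Finset.sum_nonneg fun m _ => sq_nonneg _))
  calc ∫ x, φ n x ^ 2 ≤ ∫ x, (interior C).indicator (fun _ => (1 : ℝ)) x := by
        refine integral_mono
          (((hφd n).continuous.memLp_of_hasCompactSupport (hφc n)).integrable_sq)
          ((integrable_indicator_iff isOpen_interior.measurableSet).2
            (integrableOn_const hfinC)) fun x => ?_
        by_cases hx : x ∈ interior C
        · rw [indicator_of_mem hx, ← sq_abs, ← Real.norm_eq_abs]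
          exact pow_le_one₀ (norm_nonneg _) (hφle n x)
        · rw [indicator_of_notMem hx, hφ0 n x hx]; norm_num
    _ = volume.real (interior C) := by
        rw [integral_indicator isOpen_interior.measurableSet]; simp
    _ = volume.real C := measureReal_congr hInt

theorem volume_real_scaledCube_one {ε : ℝ} (hε : 0 ≤ ε) (l : Fin d → ℤ) :
    volume.real (scaledCube ε 1 l) = ε ^ d := by
  rw [Measure.real, volume_scaledCube hε, Nat.cast_one, mul_one,
    ENNReal.toReal_ofReal (by positivity)]

theorem cellAverage_eq {ε : ℝ} (hε : 0 ≤ ε) (f : EuclideanSpace ℝ (Fin d) → ℝ) (l : Fin d → ℤ) :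
    cellAverage ε f l = (ε ^ d)⁻¹ * ∫ x in scaledCube ε 1 l, f x := by
  rw [cellAverage, setAverage_eq, volume_real_scaledCube_one hε, smul_eq_mul]

/-- The difference of two cell averages of an `H¹` function is controlled by its gradient on any
ball that contains both cells. -/
theorem IsWeakGradient.sq_cellAverage_sub_le {V : Set (EuclideanSpace ℝ (Fin d))}
    {u f : EuclideanSpace ℝ (Fin d) → ℝ} {g : Fin d → EuclideanSpace ℝ (Fin d) → ℝ}
    (hu : IsWeakGradient V u g) (hV : MeasurableSet V) (hfu : EqOn f u V)
    {ε r : ℝ} (hε : 0 < ε) {i j : Fin d → ℤ}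
    (hr : dist (latticePoint ε j) (latticePoint ε i) + d * ε ≤ r)
    (hball : Metric.closedBall (latticePoint ε i) r ⊆ V) :
    ε ^ d * (cellAverage ε f i - cellAverage ε f j) ^ 2
      ≤ r ^ 2 * ∫ x in Metric.closedBall (latticePoint ε i) r, ∑ m, g m x ^ 2 := by
  set h := latticePoint ε j - latticePoint ε i with hh
  set C := scaledCube ε 1 i with hC
  set W := Metric.closedBall (latticePoint ε i) r with hW
  have hcell : ∀ l : Fin d → ℤ, closure (scaledCube ε 1 l) ⊆
      Metric.closedBall (latticePoint ε l) (d * ε) := by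
    intro l
    refine closure_minimal ?_ Metric.isClosed_closedBall
    have := scaledCube_subset_closedBall hε.le (latticePoint_mem_scaledCube_one hε l)
    simpa using this
  have hdh : dist (latticePoint ε j) (latticePoint ε i) = ‖h‖ := dist_eq_norm _ _
  have hdε : (0 : ℝ) ≤ d * ε := by positivity
  have hsupp : ∀ x ∈ closure C, ∀ s ∈ Icc (0 : ℝ) 1, x + s • h ∈ W := by
    intro x hx s hs
    have h1 := Metric.mem_closedBall.1 (hcell i hx)
    rw [hW, Metric.mem_closedBall]
    have h2 : dist (x + s • h) x = s * ‖h‖ := by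
      rw [dist_eq_norm, add_sub_cancel_left, norm_smul, Real.norm_of_nonneg hs.1]
    have h3 : s * ‖h‖ ≤ ‖h‖ := mul_le_of_le_one_left (norm_nonneg _) hs.2
    linarith [dist_triangle (x + s • h) x (latticePoint ε i)]
  have hCb : Bornology.IsBounded C :=
    Metric.isBounded_closedBall.subset (subset_closure.trans (hcell i))
  have key := hu.sq_setIntegral_translate_sub_le hV hball
    (convex_scaledCube ε 1 i) hCb hsupp
  have hCW : C ⊆ W := fun x hx => by simpa using hsupp x (subset_closure hx) 0 (by simp)
  have htr : ∀ x, x + h ∈ scaledCube ε 1 j ↔ x ∈ C := by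
    intro x
    refine forall_congr' fun m => ?_
    simp only [hh, PiLp.add_apply, PiLp.sub_apply, latticePoint_apply, Nat.cast_one, one_mul]
    constructor <;> rintro ⟨h1, h2⟩ <;> constructor <;> linarith
  have hjW : scaledCube ε 1 j ⊆ W := by
    intro x hx
    have h1 : x - h ∈ C := (htr _).1 (by simpa using hx)
    simpa using hsupp _ (subset_closure h1) 1 (by simp)
  have hmem : MemLp (V.indicator u) 2 volume := (memLp_indicator_iff_restrict hV).2 hu.memLp
  have hfin : IsFiniteMeasure (volume.restrict C) :=
    ⟨by rw [Measure.restrict_apply_univ]; exact hCb.measure_lt_top⟩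
  have ej : ∫ x in scaledCube ε 1 j, f x = ∫ x in C, V.indicator u (x + h) := by
    have a1 : ∫ x in scaledCube ε 1 j, f x = ∫ x in scaledCube ε 1 j, V.indicator u x := by
      refine setIntegral_congr_fun (measurableSet_scaledCube _ _ _) fun x hx => ?_
      rw [indicator_of_mem (hball (hjW hx)), hfu (hball (hjW hx))]
    rw [a1, ← integral_indicator (measurableSet_scaledCube _ _ _),
      ← integral_indicator (measurableSet_scaledCube _ _ _), ← integral_add_right_eq_self _ h]
    congr 1
    funext x
    by_cases hx : x ∈ C
    · rw [indicator_of_mem hx, indicator_of_mem ((htr x).2 hx)]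
    · rw [indicator_of_notMem hx, indicator_of_notMem (mt (htr x).1 hx)]
  have ei : ∫ x in C, f x = ∫ x in C, V.indicator u x := by
    refine setIntegral_congr_fun (measurableSet_scaledCube _ _ _) fun x hx => ?_
    rw [indicator_of_mem (hball (hCW hx)), hfu (hball (hCW hx))]
  have i1 : Integrable (fun x => V.indicator u (x + h)) (volume.restrict C) :=
    ((hmem.comp_measurePreserving (measurePreserving_add_right volume h)).restrict C).integrable
      (by norm_num)
  have i2 : Integrable (V.indicator u) (volume.restrict C) := (hmem.restrict C).integrable
    (by norm_num)
  rw [integral_sub i1 i2, ← ej, ← ei, volume_real_scaledCube_one hε.le] at key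
  rw [cellAverage_eq hε.le, cellAverage_eq hε.le, ← mul_sub, mul_pow, inv_pow]
  have hεd : 0 < ε ^ d := by positivity
  have hG0 : 0 ≤ ∫ x in W, ∑ m, g m x ^ 2 :=
    integral_nonneg fun x => Finset.sum_nonneg fun m _ => sq_nonneg _
  have hhr : ‖h‖ ^ 2 ≤ r ^ 2 := pow_le_pow_left₀ (norm_nonneg _) (by linarith) 2
  have e : ε ^ d * (((ε ^ d) ^ 2)⁻¹ * ((∫ x in C, f x) - ∫ x in scaledCube ε 1 j, f x) ^ 2)
      = (((∫ x in scaledCube ε 1 j, f x) - ∫ x in C, f x) ^ 2) / ε ^ d := by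
    field_simp
    ring
  rw [e, div_le_iff₀ hεd]
  refine key.trans ?_
  gcongr

end

namespace PeriodicNetwork

variable {d k T : ℕ} (N : PeriodicNetwork d k T)

/-! ### Discrete Dirichlet sums and a Poincaré inequality on blocks -/

/-- The unscaled energy of `u` on a finite set of nodes. -/
noncomputable def dirichlet (S : Finset (Node d k)) (u : Node d k → ℝ) : ℝ :=
  ∑ i ∈ S, ∑ j ∈ S, N.a i j * (u i - u j) ^ 2

theorem energy_eq {ε : ℝ} {A : Set (EuclideanSpace ℝ (Fin d))} {S : Finset (Node d k)}
    (hS : (S : Set (Node d k)) = N.nodesIn ε A) (u : Node d k → ℝ) :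
    N.energy ε A u = ε ^ d / ε ^ 2 * N.dirichlet S u := by
  rw [energy, ← hS, finsum_mem_coe_finset, dirichlet, Finset.mul_sum]
  refine Finset.sum_congr rfl fun i _ => ?_
  rw [finsum_mem_coe_finset, Finset.mul_sum]
  refine Finset.sum_congr rfl fun j _ => ?_
  rw [div_pow]
  ring

theorem dirichlet_sub_le {S : Finset (Node d k)} (hS : (S : Set (Node d k)) ⊆ N.X)
    (u v : Node d k → ℝ) :
    N.dirichlet S (fun i => u i - v i) ≤ 2 * N.dirichlet S u + 2 * N.dirichlet S v := by
  simp only [dirichlet, Finset.mul_sum, ← Finset.sum_add_distrib]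
  refine Finset.sum_le_sum fun i hi => Finset.sum_le_sum fun j hj => ?_
  have h1 := N.a_nonneg (hS hi) (hS hj)
  have h2 : (u i - v i - (u j - v j)) ^ 2 ≤ 2 * (u i - u j) ^ 2 + 2 * (v i - v j) ^ 2 := by
    nlinarith [sq_nonneg ((u i - u j) + (v i - v j))]
  nlinarith [mul_le_mul_of_nonneg_left h2 h1]

/-- The squared increments along a path of edges, summed over a set `L` of translates of the path,
are controlled by the Dirichlet sum over any set of nodes that contains these translates. The
set `P` is the set of nodes of the path. -/
theorem exists_sum_sq_sub_le_dirichlet (hT : 1 ≤ T) {p q : Node d k}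
    (h : Relation.ReflTransGen (fun p q => (p, q) ∈ N.E) p q) :
    ∃ (C : ℝ) (P : Finset (Node d k)), 0 ≤ C ∧ (P : Set (Node d k)) ⊆ N.X ∧
      ∀ S : Finset (Node d k), (S : Set (Node d k)) ⊆ N.X → ∀ L : Finset (Fin d → ℤ),
      (∀ l ∈ L, ∀ x ∈ P, x.translate T l ∈ S) → ∀ u : Node d k → ℝ,
      ∑ l ∈ L, (u (p.translate T l) - u (q.translate T l)) ^ 2 ≤ C * N.dirichlet S u := by
  classical
  induction h with
  | refl => exact ⟨0, ∅, le_rfl, by simp, fun S hS L hL u => by simp⟩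
  | @tail q q' _ hqq' ih =>
    obtain ⟨C, P, hC, hP, ih⟩ := ih
    have hapos := N.a_pos _ _ hqq'
    obtain ⟨hq, hq'⟩ := N.E_subset hqq'
    refine ⟨2 * C + 2 / N.a q q', P ∪ {q, q'}, by positivity, ?_, fun S hS L hL u => ?_⟩
    · intro x hx
      simp only [Finset.coe_union, Finset.coe_insert, Finset.coe_singleton, Set.mem_union,
        Set.mem_insert_iff, Set.mem_singleton_iff] at hx
      rcases hx with hx | rfl | rfl
      exacts [hP hx, hq, hq']
    have h1 := ih S hS L (fun l hl x hx => hL l hl x (Finset.mem_union_left _ hx)) u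
    have h2 : N.a q q' * ∑ l ∈ L, (u (q.translate T l) - u (q'.translate T l)) ^ 2
        ≤ N.dirichlet S u := by
      rw [Finset.mul_sum, dirichlet, ← Finset.sum_product']
      have hinj : Set.InjOn (fun l => (q.translate T l, q'.translate T l)) L :=
        fun l _ l' _ hll' => Node.translate_left_injective hT q (Prod.ext_iff.1 hll').1
      have e : ∑ l ∈ L, N.a q q' * (u (q.translate T l) - u (q'.translate T l)) ^ 2
          = ∑ e ∈ L.image (fun l => (q.translate T l, q'.translate T l)),
            N.a e.1 e.2 * (u e.1 - u e.2) ^ 2 := by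
        rw [Finset.sum_image hinj]
        exact Finset.sum_congr rfl fun l _ => by rw [N.a_translate l hq hq']
      rw [e]
      refine Finset.sum_le_sum_of_subset_of_nonneg ?_ fun e he _ => ?_
      · intro e he
        obtain ⟨l, hl, rfl⟩ := Finset.mem_image.1 he
        exact Finset.mem_product.2 ⟨hL l hl q (by simp), hL l hl q' (by simp)⟩
      · obtain ⟨h3, h4⟩ := Finset.mem_product.1 he
        exact mul_nonneg (N.a_nonneg (hS h3) (hS h4)) (sq_nonneg _)
    have h3 : ∑ l ∈ L, (u (q.translate T l) - u (q'.translate T l)) ^ 2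
        ≤ N.dirichlet S u / N.a q q' := by
      rw [le_div_iff₀ hapos]; linarith
    calc ∑ l ∈ L, (u (p.translate T l) - u (q'.translate T l)) ^ 2
        ≤ ∑ l ∈ L, (2 * (u (p.translate T l) - u (q.translate T l)) ^ 2
            + 2 * (u (q.translate T l) - u (q'.translate T l)) ^ 2) := by
          refine Finset.sum_le_sum fun l _ => ?_
          nlinarith [sq_nonneg ((u (p.translate T l) - u (q.translate T l))
            - (u (q.translate T l) - u (q'.translate T l)))]
      _ = 2 * ∑ l ∈ L, (u (p.translate T l) - u (q.translate T l)) ^ 2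
            + 2 * ∑ l ∈ L, (u (q.translate T l) - u (q'.translate T l)) ^ 2 := by
          rw [Finset.sum_add_distrib, Finset.mul_sum, Finset.mul_sum]
      _ ≤ 2 * (C * N.dirichlet S u) + 2 * (N.dirichlet S u / N.a q q') := by linarith
      _ = (2 * C + 2 / N.a q q') * N.dirichlet S u := by ring

/-- Discrete Poincaré inequality on blocks, uniform in the blocks: the `ℓ²` norm over a set of
blocks is controlled by the block means and the Dirichlet sum. -/
theorem exists_sum_sq_le_blockMean_add_dirichlet (hT : 1 ≤ T) (hX : N.X.Nonempty) :
    ∃ (C : ℝ) (P : Finset (Node d k)), 0 ≤ C ∧ (P : Set (Node d k)) ⊆ N.X ∧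
      ∀ S : Finset (Node d k), (S : Set (Node d k)) ⊆ N.X → ∀ L : Finset (Fin d → ℤ),
      (∀ l ∈ L, ∀ x ∈ P, x.translate T l ∈ S) → ∀ u : Node d k → ℝ,
      ∑ l ∈ L, ∑ p ∈ N.cell, u (p.translate T l) ^ 2
        ≤ 2 * N.cell.card * ∑ l ∈ L, N.blockMean u l ^ 2 + C * N.dirichlet S u := by
  classical
  have hb : (0 : ℝ) < N.cell.card := by exact_mod_cast N.cell_card_pos hT hX
  have hcell : ∀ p ∈ N.cell, p ∈ N.X := fun p hp => (N.mem_cell.1 hp).1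
  choose! C P hC hPX hCP using fun (p : Node d k) (q : Node d k) (h : p ∈ N.cell ∧ q ∈ N.cell) =>
    N.exists_sum_sq_sub_le_dirichlet hT
      (N.E_connected p (hcell p h.1) q (hcell q h.2))
  refine ⟨2 / N.cell.card * ∑ p ∈ N.cell, ∑ q ∈ N.cell, C p q,
    N.cell.biUnion fun p => N.cell.biUnion fun q => P p q, ?_, ?_, fun S hS L hL u => ?_⟩
  · exact mul_nonneg (by positivity) (Finset.sum_nonneg fun p hp =>
      Finset.sum_nonneg fun q hq => hC p q ⟨hp, hq⟩)
  · intro x hx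
    obtain ⟨p, hp, hx⟩ := Finset.mem_biUnion.1 (Finset.mem_coe.1 hx)
    obtain ⟨q, hq, hx⟩ := Finset.mem_biUnion.1 hx
    exact hPX p q ⟨hp, hq⟩ hx
  have h1 : ∑ l ∈ L, ∑ p ∈ N.cell, ∑ q ∈ N.cell, (u (p.translate T l) - u (q.translate T l)) ^ 2
      ≤ (∑ p ∈ N.cell, ∑ q ∈ N.cell, C p q) * N.dirichlet S u := by
    rw [Finset.sum_comm, Finset.sum_mul]
    refine Finset.sum_le_sum fun p hp => ?_
    rw [Finset.sum_comm, Finset.sum_mul]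
    refine Finset.sum_le_sum fun q hq => hCP p q ⟨hp, hq⟩ S hS L (fun l hl x hx => ?_) u
    exact hL l hl x (Finset.mem_biUnion.2 ⟨p, hp, Finset.mem_biUnion.2 ⟨q, hq, hx⟩⟩)
  have h2 : ∀ l ∈ L, ∑ p ∈ N.cell, u (p.translate T l) ^ 2
      ≤ 2 * N.cell.card * N.blockMean u l ^ 2 + 2 / N.cell.card *
        ∑ p ∈ N.cell, ∑ q ∈ N.cell, (u (p.translate T l) - u (q.translate T l)) ^ 2 := by
    intro l _
    have h3 : ∀ p ∈ N.cell, u (p.translate T l) ^ 2 ≤ 2 * N.blockMean u l ^ 2 + 2 / N.cell.card *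
        ∑ q ∈ N.cell, (u (p.translate T l) - u (q.translate T l)) ^ 2 := by
      intro p _
      have h4 : N.cell.card * (u (p.translate T l) - N.blockMean u l)
          = ∑ q ∈ N.cell, (u (p.translate T l) - u (q.translate T l)) := by
        rw [N.blockMean_eq, Finset.sum_sub_distrib, Finset.sum_const, nsmul_eq_mul, mul_sub,
          mul_div_cancel₀ _ hb.ne']
      have h5 := sq_sum_le_card_mul_sum_sq (s := N.cell)
        (f := fun q => u (p.translate T l) - u (q.translate T l))
      rw [← h4, mul_pow, sq (N.cell.card : ℝ), mul_assoc, mul_le_mul_iff_right₀ hb] at h5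
      have h6 : (u (p.translate T l) - N.blockMean u l) ^ 2 ≤ 1 / N.cell.card *
          ∑ q ∈ N.cell, (u (p.translate T l) - u (q.translate T l)) ^ 2 := by
        rw [one_div, ← div_eq_inv_mul, le_div_iff₀ hb]; linarith
      have h7 : 2 / (N.cell.card : ℝ) = 2 * (1 / N.cell.card) := by ring
      rw [h7, mul_assoc]
      nlinarith [sq_nonneg (u (p.translate T l) - 2 * N.blockMean u l)]
    refine (Finset.sum_le_sum h3).trans (le_of_eq ?_)
    rw [Finset.sum_add_distrib, Finset.sum_const, nsmul_eq_mul, ← Finset.mul_sum]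
    ring
  calc ∑ l ∈ L, ∑ p ∈ N.cell, u (p.translate T l) ^ 2
      ≤ 2 * N.cell.card * ∑ l ∈ L, N.blockMean u l ^ 2 + 2 / N.cell.card *
        ∑ l ∈ L, ∑ p ∈ N.cell, ∑ q ∈ N.cell,
          (u (p.translate T l) - u (q.translate T l)) ^ 2 := by
        refine (Finset.sum_le_sum h2).trans (le_of_eq ?_)
        rw [Finset.sum_add_distrib, ← Finset.mul_sum, ← Finset.mul_sum]
    _ ≤ _ := by
        rw [mul_assoc (2 / (N.cell.card : ℝ))]
        gcongr

/-! ### The energy of an interpolation -/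

theorem sq_sub_interpolate_le {s t u₁ u₂ v₁ v₂ η : ℝ} (hs : 0 ≤ s) (hs1 : s ≤ 1) (hη : 0 < η) :
    ((v₁ + s * (u₁ - v₁)) - (v₂ + t * (u₂ - v₂))) ^ 2
      ≤ (1 + η) * (u₁ - u₂) ^ 2 + (1 + η) * ((1 - s) * (v₁ - v₂) ^ 2)
        + (1 + η⁻¹) * ((s - t) ^ 2 * (u₂ - v₂) ^ 2) := by
  set a := u₁ - u₂ with ha
  set b := v₁ - v₂ with hb
  set c := (s - t) * (u₂ - v₂) with hc
  have e : (v₁ + s * (u₁ - v₁)) - (v₂ + t * (u₂ - v₂)) = (s * a + (1 - s) * b) + c := by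
    rw [ha, hb, hc]; ring
  have e2 : (s - t) ^ 2 * (u₂ - v₂) ^ 2 = c ^ 2 := by rw [hc]; ring
  rw [e, e2]
  have h1 : (s * a + (1 - s) * b) ^ 2 ≤ s * a ^ 2 + (1 - s) * b ^ 2 := by
    nlinarith [mul_nonneg (mul_nonneg hs (sub_nonneg.2 hs1)) (sq_nonneg (a - b))]
  have h2 : s * a ^ 2 ≤ a ^ 2 := mul_le_of_le_one_left (sq_nonneg _) hs1
  set z := s * a + (1 - s) * b with hz
  have h3 : (z + c) ^ 2 ≤ (1 + η) * z ^ 2 + (1 + η⁻¹) * c ^ 2 := by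
    have h4 : 0 ≤ η⁻¹ * (η * z - c) ^ 2 := by positivity
    have h5 : η⁻¹ * (η * z - c) ^ 2 = η * z ^ 2 - 2 * z * c + η⁻¹ * c ^ 2 := by
      field_simp
      ring
    nlinarith
  nlinarith

/-- The energy of the interpolation `v + φ (u - v)`: convexity makes a choice of a particular
transition layer unnecessary. -/
theorem dirichlet_interpolate_le {S : Finset (Node d k)} (hS : (S : Set (Node d k)) ⊆ N.X)
    {u v w φ : Node d k → ℝ} (hφ : ∀ i, 0 ≤ φ i) (hφ1 : ∀ i, φ i ≤ 1)
    (hw : ∀ i ∈ S, w i = v i + φ i * (u i - v i)) {η : ℝ} (hη : 0 < η) :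
    N.dirichlet S w ≤ (1 + η) * N.dirichlet S u
      + (1 + η) * ∑ i ∈ S, ∑ j ∈ S, N.a i j * ((1 - φ i) * (v i - v j) ^ 2)
      + (1 + η⁻¹) * ∑ i ∈ S, ∑ j ∈ S, N.a i j * ((φ i - φ j) ^ 2 * (u j - v j) ^ 2) := by
  simp only [dirichlet, Finset.mul_sum, ← Finset.sum_add_distrib]
  refine Finset.sum_le_sum fun i hi => Finset.sum_le_sum fun j hj => ?_
  rw [hw i hi, hw j hj]
  refine (mul_le_mul_of_nonneg_left (sq_sub_interpolate_le (hφ i) (hφ1 i) hη)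
    (N.a_nonneg (hS hi) (hS hj))).trans (le_of_eq ?_)
  ring

/-- A sum over nodes whose terms are at most `B`, and are nonpositive away from a point `y`. -/
theorem sum_le_of_near {r : ℝ} {M : ℕ}
    (hM : ∀ y : Fin d → ℝ, {i ∈ N.X | ∀ m, |(i.1 m : ℝ) - y m| ≤ r}.Finite ∧
      {i ∈ N.X | ∀ m, |(i.1 m : ℝ) - y m| ≤ r}.ncard ≤ M)
    {S : Finset (Node d k)} (hS : (S : Set (Node d k)) ⊆ N.X) (y : Fin d → ℝ)
    {b : Node d k → ℝ} {B : ℝ} (hB : 0 ≤ B) (hb : ∀ j ∈ S, b j ≤ B)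
    (hfar : ∀ j ∈ S, ¬ (∀ m, |(j.1 m : ℝ) - y m| ≤ r) → b j ≤ 0) :
    ∑ j ∈ S, b j ≤ M * B := by
  classical
  calc ∑ j ∈ S, b j ≤ ∑ j ∈ S, if (∀ m, |(j.1 m : ℝ) - y m| ≤ r) then B else 0 := by
        refine Finset.sum_le_sum fun j hj => ?_
        split_ifs with h
        · exact hb j hj
        · exact hfar j hj h
    _ = (S.filter fun j => ∀ m, |(j.1 m : ℝ) - y m| ≤ r).card * B := by
        rw [← Finset.sum_filter, Finset.sum_const, nsmul_eq_mul]
    _ ≤ M * B := by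
        refine mul_le_mul_of_nonneg_right ?_ hB
        have : (S.filter fun j => ∀ m, |(j.1 m : ℝ) - y m| ≤ r).card ≤ M := by
          rw [← Set.ncard_coe_finset]
          refine (Set.ncard_le_ncard ?_ (hM y).1).trans (hM y).2
          intro j hj
          rw [Finset.mem_coe, Finset.mem_filter] at hj
          exact ⟨hS hj.1, hj.2⟩
        exact_mod_cast this

/-- The energy of the cell averages of an `H¹` function, over the pairs whose first node lies in
`S'`, is controlled by the Dirichlet integral over a neighbourhood `W` of these nodes. The ball of
radius `ε (R + d)` about a node contains its cell and the cells of all nodes joined to it; since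
such balls overlap a bounded number of times, their Dirichlet integrals can be summed. -/
theorem sum_cellAverage_le {V W : Set (EuclideanSpace ℝ (Fin d))}
    {u f : EuclideanSpace ℝ (Fin d) → ℝ} {g : Fin d → EuclideanSpace ℝ (Fin d) → ℝ}
    (hu : IsWeakGradient V u g) (hV : MeasurableSet V) (hfu : EqOn f u V)
    (hWV : W ⊆ V)
    {R K : ℝ} (hR : 0 < R) (hER : ∀ i j : Node d k, (i, j) ∈ N.E → i.eucDist j ≤ R)
    (hK0 : 0 < K) (hK : ∀ i ∈ N.X, ∀ j ∈ N.X, N.a i j ≤ K) {M : ℕ}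
    (hM : ∀ y : Fin d → ℝ, {i ∈ N.X | ∀ m, |(i.1 m : ℝ) - y m| ≤ R + d}.Finite ∧
      {i ∈ N.X | ∀ m, |(i.1 m : ℝ) - y m| ≤ R + d}.ncard ≤ M)
    {S S' : Finset (Node d k)} (hS : (S : Set (Node d k)) ⊆ N.X)
    (hS' : (S' : Set (Node d k)) ⊆ N.X) {ε : ℝ} (hε : 0 < ε)
    (hball : ∀ i ∈ S', Metric.closedBall (latticePoint ε i.1) (ε * (R + d)) ⊆ W) :
    ε ^ d / ε ^ 2 * ∑ i ∈ S', ∑ j ∈ S, N.a i j *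
        (cellAverage ε f i.1 - cellAverage ε f j.1) ^ 2
      ≤ M * (K * (R + d) ^ 2) * (M * ∫ x in W, ∑ m, g m x ^ 2) := by
  set G : EuclideanSpace ℝ (Fin d) → ℝ := fun x => ∑ m, g m x ^ 2 with hG
  have hG0 : ∀ x, 0 ≤ G x := fun x => Finset.sum_nonneg fun m _ => sq_nonneg _
  have hGV : IntegrableOn G V :=
    integrable_finsetSum _ fun m _ => (hu.memLp_grad m).integrable_sq
  have hRd : 0 < R + d := by positivity
  set B : Node d k → Set (EuclideanSpace ℝ (Fin d)) :=
    fun i => Metric.closedBall (latticePoint ε i.1) (ε * (R + d)) with hB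
  have hI0 : ∀ i, 0 ≤ ∫ x in B i, G x := fun i => integral_nonneg hG0
  have h1 : ∀ i ∈ S', ε ^ d / ε ^ 2 * ∑ j ∈ S, N.a i j *
      (cellAverage ε f i.1 - cellAverage ε f j.1) ^ 2
        ≤ M * (K * (R + d) ^ 2 * ∫ x in B i, G x) := by
    intro i hi
    rw [Finset.mul_sum]
    refine N.sum_le_of_near hM hS (fun m => (i.1 m : ℝ)) (by have := hI0 i; positivity)
      (fun j hj => ?_) fun j hj hfar => ?_
    · by_cases hE : (i, j) ∈ N.E
      swap
      · rw [N.a_zero i (hS' hi) j (hS hj) hE, zero_mul, mul_zero]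
        have := hI0 i; positivity
      have hd : dist (latticePoint ε j.1) (latticePoint ε i.1) + d * ε ≤ ε * (R + d) := by
        rw [dist_comm]
        nlinarith [dist_latticePoint_le hε.le i j, hER i j hE]
      have key := hu.sq_cellAverage_sub_le hV hfu hε hd ((hball i hi).trans hWV)
      have ha := hK i (hS' hi) j (hS hj)
      have ha0 := N.a_nonneg (hS' hi) (hS hj)
      calc ε ^ d / ε ^ 2 * (N.a i j * (cellAverage ε f i.1 - cellAverage ε f j.1) ^ 2)
          = N.a i j * (ε ^ d * (cellAverage ε f i.1 - cellAverage ε f j.1) ^ 2) / ε ^ 2 := by ring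
        _ ≤ K * ((ε * (R + d)) ^ 2 * ∫ x in B i, G x) / ε ^ 2 := by
            refine div_le_div_of_nonneg_right ?_ (sq_nonneg _)
            exact mul_le_mul ha key (by positivity) hK0.le
        _ = K * (R + d) ^ 2 * ∫ x in B i, G x := by
            field_simp
    · have hE : (i, j) ∉ N.E := by
        intro hE
        refine hfar fun m => ?_
        rw [abs_sub_comm]
        exact (abs_sub_le_eucDist i j m).trans ((hER i j hE).trans
          (le_add_of_nonneg_right (Nat.cast_nonneg d)))
      rw [N.a_zero i (hS' hi) j (hS hj) hE, zero_mul, mul_zero]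
  have h2 : ∑ i ∈ S', ∫ x in B i, G x ≤ M * ∫ x in W, G x := by
    have hmB : ∀ i, MeasurableSet (B i) := fun i => Metric.isClosed_closedBall.measurableSet
    have hGW : IntegrableOn G W := hGV.mono_set hWV
    have e : ∀ i ∈ S', ∫ x in B i, G x = ∫ x in W, (B i).indicator G x := by
      intro i hi
      rw [setIntegral_indicator (hmB i), inter_eq_self_of_subset_right (hball i hi)]
    rw [Finset.sum_congr rfl e, ← integral_finsetSum, ← integral_const_mul]
    swap
    · exact fun i _ => hGW.indicator (hmB i)
    refine integral_mono (integrable_finsetSum _ fun i _ => hGW.indicator (hmB i))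
      (hGW.const_mul _) fun x => ?_
    refine N.sum_le_of_near hM hS' (fun m => x m / ε) (hG0 x)
      (fun i hi => indicator_le_self' (fun _ _ => hG0 x) x) fun i hi hfar => le_of_eq ?_
    refine indicator_of_notMem (fun hx => hfar fun m => ?_) _
    have h3 := (EuclideanSpace.abs_sub_apply_le_dist _ _ m).trans (Metric.mem_closedBall.1 hx)
    rw [latticePoint_apply, abs_sub_comm] at h3
    have h4 : (i.1 m : ℝ) - x m / ε = (ε * i.1 m - x m) / ε := by field_simp
    rw [h4, abs_div, abs_of_pos hε, div_le_iff₀ hε]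
    linarith
  rw [Finset.mul_sum]
  refine (Finset.sum_le_sum h1).trans ?_
  rw [← Finset.mul_sum, ← Finset.mul_sum, ← mul_assoc]
  gcongr

/-- The coupling term of an interpolation whose weight `φ` is Lipschitz at the scale of the
interactions: only the nodes of `S'` see a variation of `φ`. -/
theorem sum_coupling_le
    {R K : ℝ} (hER : ∀ i j : Node d k, (i, j) ∈ N.E → i.eucDist j ≤ R)
    (hK : ∀ i ∈ N.X, ∀ j ∈ N.X, N.a i j ≤ K) (hK0 : 0 < K) {M : ℕ}
    (hM : ∀ y : Fin d → ℝ, {i ∈ N.X | ∀ m, |(i.1 m : ℝ) - y m| ≤ R + d}.Finite ∧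
      {i ∈ N.X | ∀ m, |(i.1 m : ℝ) - y m| ≤ R + d}.ncard ≤ M)
    {S S' : Finset (Node d k)} (hS : (S : Set (Node d k)) ⊆ N.X) (hSS' : S' ⊆ S)
    {φ z : Node d k → ℝ} {c : ℝ} (hc : 0 ≤ c)
    (hφ : ∀ i ∈ S, ∀ j ∈ S, (i, j) ∈ N.E → (φ i - φ j) ^ 2 ≤ c)
    (hφ' : ∀ i ∈ S, ∀ j ∈ S, (i, j) ∈ N.E → j ∉ S' → φ i = φ j) :
    ∑ i ∈ S, ∑ j ∈ S, N.a i j * ((φ i - φ j) ^ 2 * z j ^ 2)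
      ≤ M * (K * c) * ∑ j ∈ S', z j ^ 2 := by
  rw [Finset.sum_comm, Finset.mul_sum]
  have h0 : ∀ j ∈ S, j ∉ S' → ∑ i ∈ S, N.a i j * ((φ i - φ j) ^ 2 * z j ^ 2) = 0 := by
    intro j hj hj'
    refine Finset.sum_eq_zero fun i hi => ?_
    by_cases hE : (i, j) ∈ N.E
    · rw [hφ' i hi j hj hE hj']; simp
    · rw [N.a_zero i (hS hi) j (hS hj) hE, zero_mul]
  rw [← Finset.sum_subset hSS' h0]
  refine Finset.sum_le_sum fun j hj => ?_
  have hjS := hSS' hj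
  rw [mul_assoc]
  refine N.sum_le_of_near hM hS (fun m => (j.1 m : ℝ)) (by positivity)
    (fun i hi => ?_) fun i hi hfar => ?_
  · by_cases hE : (i, j) ∈ N.E
    · rw [mul_assoc]
      exact mul_le_mul (hK i (hS hi) j (hS hjS)) (mul_le_mul_of_nonneg_right (hφ i hi j hjS hE)
        (sq_nonneg _)) (by positivity) hK0.le
    · rw [N.a_zero i (hS hi) j (hS hjS) hE, zero_mul]; positivity
  · have hE : (i, j) ∉ N.E := fun hE => hfar fun m =>
      (abs_sub_le_eucDist i j m).trans ((hER i j hE).trans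
        (le_add_of_nonneg_right (Nat.cast_nonneg d)))
    rw [N.a_zero i (hS hi) j (hS hjS) hE, zero_mul]

end PeriodicNetwork

/-! ### Coarse-graining in `L²` -/

theorem eLpNorm_two_sq {α : Type*} [MeasurableSpace α] {μ : Measure α} (f : α → ℝ) :
    eLpNorm f 2 μ ^ 2 = ∫⁻ x, ‖f x‖ₑ ^ 2 ∂μ := by
  have := eLpNorm_nnreal_pow_eq_lintegral (μ := μ) (f := f) (p := 2) two_ne_zero
  simpa using this

theorem enorm_sq_eq_ofReal (x : ℝ) : ‖x‖ₑ ^ 2 = ENNReal.ofReal (x ^ 2) := by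
  rw [Real.enorm_eq_ofReal_abs, ← ENNReal.ofReal_pow (abs_nonneg x), sq_abs]

theorem eventually_mul_lt {c ρ : ℝ} (hρ : 0 < ρ) : ∀ᶠ ε : ℝ in 𝓝[>] 0, c * ε < ρ := by
  have h : Tendsto (fun ε : ℝ => c * ε) (𝓝[>] 0) (𝓝 0) := by
    have : Tendsto (fun ε : ℝ => c * ε) (𝓝 0) (𝓝 (c * 0)) := tendsto_id.const_mul c
    rw [mul_zero] at this
    exact this.mono_left nhdsWithin_le_nhds
  exact h.eventually_lt_const hρ

theorem eventually_pos_nhdsGT : ∀ᶠ ε : ℝ in 𝓝[>] 0, 0 < ε := self_mem_nhdsWithin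

theorem pairwise_disjoint_scaledCube {d T : ℕ} {ε : ℝ} (hε : 0 < ε) (hT : 1 ≤ T) :
    Pairwise (Function.onFun Disjoint (scaledCube ε T : (Fin d → ℤ) → _)) := by
  intro l l' h
  refine disjoint_left.2 fun x hx hx' => h ?_
  rw [← (mem_scaledCube_iff hε hT).1 hx, (mem_scaledCube_iff hε hT).1 hx']

theorem iUnion_scaledCube {d T : ℕ} {ε : ℝ} (hε : 0 < ε) (hT : 1 ≤ T) :
    ⋃ l : Fin d → ℤ, scaledCube ε T l = univ :=
  eq_univ_of_forall fun _ => mem_iUnion.2 ⟨_, (mem_scaledCube_iff hε hT).2 rfl⟩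

theorem isBounded_scaledCube {d T : ℕ} {ε : ℝ} (hε : 0 ≤ ε) (l : Fin d → ℤ) :
    Bornology.IsBounded (scaledCube ε T l) := by
  rcases (scaledCube ε T l).eq_empty_or_nonempty with h | ⟨y, hy⟩
  · rw [h]; exact Bornology.isBounded_empty
  · exact Metric.isBounded_closedBall.subset (scaledCube_subset_closedBall hε hy)

theorem MeasureTheory.MemLp.integrableOn_scaledCube {d T : ℕ} {ε : ℝ} (hε : 0 ≤ ε) (l : Fin d → ℤ)
    {f : EuclideanSpace ℝ (Fin d) → ℝ} (hf : MemLp f 2 volume) :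
    IntegrableOn f (scaledCube ε T l) := by
  have : IsFiniteMeasure (volume.restrict (scaledCube ε T l)) :=
    ⟨by rw [Measure.restrict_apply_univ]; exact (isBounded_scaledCube hε l).measure_lt_top⟩
  exact (hf.restrict _).integrable (by norm_num)

/-- Jensen's inequality for cell averages. -/
theorem sq_cellAverage_le {d : ℕ} {ε : ℝ} (hε : 0 < ε) {f : EuclideanSpace ℝ (Fin d) → ℝ}
    (hf : MemLp f 2 volume) (l : Fin d → ℤ) :
    cellAverage ε f l ^ 2 ≤ (ε ^ d)⁻¹ * ∫ x in scaledCube ε 1 l, f x ^ 2 := by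
  have hfin : IsFiniteMeasure (volume.restrict (scaledCube ε 1 l)) :=
    ⟨by rw [Measure.restrict_apply_univ]; exact (isBounded_scaledCube hε.le l).measure_lt_top⟩
  have key := sq_integral_mul_le (hf.restrict (scaledCube ε 1 l))
    (memLp_const (1 : ℝ) (μ := volume.restrict (scaledCube ε 1 l)))
  have hvol := volume_real_scaledCube_one hε.le l
  have e : ∫ _x in scaledCube ε 1 l, (1 : ℝ) ^ 2 = ε ^ d := by
    simpa using hvol
  rw [e] at key
  simp only [mul_one] at key
  have hεd : 0 < ε ^ d := by positivity
  rw [cellAverage_eq hε.le, mul_pow, inv_pow]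
  calc ((ε ^ d) ^ 2)⁻¹ * (∫ x in scaledCube ε 1 l, f x) ^ 2
      ≤ ((ε ^ d) ^ 2)⁻¹ * ((∫ x in scaledCube ε 1 l, f x ^ 2) * ε ^ d) := by gcongr
    _ = (ε ^ d)⁻¹ * ∫ x in scaledCube ε 1 l, f x ^ 2 := by field_simp

theorem cellAverage_sub {d : ℕ} {ε : ℝ} (hε : 0 < ε) {f g : EuclideanSpace ℝ (Fin d) → ℝ}
    (hf : MemLp f 2 volume) (hg : MemLp g 2 volume) (l : Fin d → ℤ) :
    cellAverage ε (f - g) l = cellAverage ε f l - cellAverage ε g l := by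
  rw [cellAverage_eq hε.le, cellAverage_eq hε.le, cellAverage_eq hε.le, ← mul_sub]
  congr 1
  exact integral_sub (hf.integrableOn_scaledCube hε.le l) (hg.integrableOn_scaledCube hε.le l)

theorem abs_cellAverage_sub_le {d : ℕ} {ε : ℝ} (hε : 0 < ε) {f : EuclideanSpace ℝ (Fin d) → ℝ}
    (hf : MemLp f 2 volume) (l : Fin d → ℤ) {c η : ℝ}
    (h : ∀ x ∈ scaledCube ε 1 l, |f x - c| ≤ η) : |cellAverage ε f l - c| ≤ η := by
  have hεd : 0 < ε ^ d := by positivity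
  have hfin := (isBounded_scaledCube (T := 1) hε.le l).measure_lt_top (μ := volume)
  have e : cellAverage ε f l - c = (ε ^ d)⁻¹ * ∫ x in scaledCube ε 1 l, (f x - c) := by
    rw [integral_sub (hf.integrableOn_scaledCube hε.le l) (integrableOn_const hfin.ne),
      cellAverage_eq hε.le, setIntegral_const, volume_real_scaledCube_one hε.le, smul_eq_mul]
    field_simp
  have key := norm_setIntegral_le_of_norm_le_const hfin
    (fun x hx => (Real.norm_eq_abs _).trans_le (h x hx))
  rw [volume_real_scaledCube_one hε.le, Real.norm_eq_abs] at key
  rw [e, abs_mul, abs_of_pos (inv_pos.2 hεd)]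
  calc (ε ^ d)⁻¹ * |∫ x in scaledCube ε 1 l, (f x - c)| ≤ (ε ^ d)⁻¹ * (η * ε ^ d) := by gcongr
    _ = η := by field_simp

namespace PeriodicNetwork

variable {d k T : ℕ} (N : PeriodicNetwork d k T)

theorem coarse_apply {Ω : Set (EuclideanSpace ℝ (Fin d))} {ε : ℝ} (hε : 0 < ε) (hT : 1 ≤ T)
    (u : Node d k → ℝ) {x : EuclideanSpace ℝ (Fin d)} {l : Fin d → ℤ}
    (hx : x ∈ scaledCube ε T l) [Decidable (scaledCube ε T l ⊆ Ω)] :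
    N.coarse Ω ε u x = if scaledCube ε T l ⊆ Ω then N.blockMean u l else 0 := by
  rw [coarse, finsum_eq_single _ l]
  · split_ifs with h
    · rw [finsum_eq_single _ (show l ∈ {l : Fin d → ℤ | scaledCube ε T l ⊆ Ω} from h)
        (fun h1 h2 => absurd rfl h2), indicator_of_mem hx]
    · simp [h]
  · intro l' hl'
    have hx' : x ∉ scaledCube ε T l' := fun hx' =>
      disjoint_left.1 (pairwise_disjoint_scaledCube hε hT hl') hx' hx
    simp [indicator_of_notMem hx']

theorem coarse_of_subset {Ω : Set (EuclideanSpace ℝ (Fin d))} {ε : ℝ} (hε : 0 < ε) (hT : 1 ≤ T)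
    (u : Node d k → ℝ) {x : EuclideanSpace ℝ (Fin d)} {l : Fin d → ℤ}
    (hx : x ∈ scaledCube ε T l) (h : scaledCube ε T l ⊆ Ω) :
    N.coarse Ω ε u x = N.blockMean u l := by
  classical
  rw [N.coarse_apply hε hT u hx, if_pos h]

theorem measurable_coarse (Ω : Set (EuclideanSpace ℝ (Fin d))) {ε : ℝ} (hε : 0 < ε) (hT : 1 ≤ T)
    (u : Node d k → ℝ) : Measurable (N.coarse Ω ε u) := by
  classical
  have e : N.coarse Ω ε u =
      (fun l => if scaledCube ε T l ⊆ Ω then N.blockMean u l else 0) ∘ cubeIndex ε T := by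
    funext x
    exact N.coarse_apply hε hT u ((mem_scaledCube_iff hε hT).2 rfl)
  rw [e]
  refine Measurable.of_discrete.comp (measurable_pi_lambda _ fun m => ?_)
  have hm : Measurable fun x : EuclideanSpace ℝ (Fin d) => x m := by fun_prop
  exact (hm.div_const _).floor

theorem coarse_sub (Ω : Set (EuclideanSpace ℝ (Fin d))) {ε : ℝ} (hε : 0 < ε) (hT : 1 ≤ T)
    (u v : Node d k → ℝ) (x : EuclideanSpace ℝ (Fin d)) :
    N.coarse Ω ε u x - N.coarse Ω ε v x = N.coarse Ω ε (fun i => u i - v i) x := by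
  classical
  have hx : x ∈ scaledCube ε T (cubeIndex ε T x) := (mem_scaledCube_iff hε hT).2 rfl
  rw [N.coarse_apply hε hT _ hx, N.coarse_apply hε hT _ hx, N.coarse_apply hε hT _ hx,
    blockMean_sub]
  split_ifs <;> simp

/-- Coarse-graining the cell averages is bounded in `L²`, uniformly in `ε`. -/
theorem eLpNorm_coarse_cellAverage_le (hT : 1 ≤ T) (hX : N.X.Nonempty) {ε : ℝ} (hε : 0 < ε)
    {f : EuclideanSpace ℝ (Fin d) → ℝ} (hf : MemLp f 2 volume) :
    eLpNorm (N.coarse univ ε fun i => cellAverage ε f i.1) 2 volume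
      ≤ ENNReal.ofReal (T ^ d) * eLpNorm f 2 volume := by
  have hb := N.cell_card_pos hT hX
  have hb' : (0 : ℝ) < N.cell.card := by exact_mod_cast hb
  have hT1 : (1 : ℝ) ≤ (T : ℝ) ^ d := one_le_pow₀ (by exact_mod_cast hT)
  have hmean : ∀ l, N.blockMean (fun i => cellAverage ε f i.1) l ^ 2
      ≤ (ε ^ d)⁻¹ * ∫ x in scaledCube ε T l, f x ^ 2 := by
    intro l
    refine (N.sq_blockMean_le hb _ l).trans ?_
    rw [div_le_iff₀ hb', mul_comm _ (N.cell.card : ℝ), ← nsmul_eq_mul]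
    refine Finset.sum_le_card_nsmul _ _ _ fun p hp => ?_
    refine (sq_cellAverage_le hε hf _).trans ?_
    refine mul_le_mul_of_nonneg_left ?_ (by positivity)
    refine setIntegral_mono_set hf.integrable_sq.integrableOn
      (Eventually.of_forall fun x => sq_nonneg _) (Eventually.of_forall ?_)
    exact scaledCube_one_subset hε (N.translate_mem_block_iff.2 (N.mem_cell.1 hp)).2
  rw [← ENNReal.pow_le_pow_left_iff two_ne_zero]
  rw [mul_pow, eLpNorm_two_sq, eLpNorm_two_sq]
  have hsum : ∀ h : EuclideanSpace ℝ (Fin d) → ENNReal,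
      ∫⁻ x, h x = ∑' l : Fin d → ℤ, ∫⁻ x in scaledCube ε T l, h x := by
    intro h
    rw [← lintegral_iUnion (measurableSet_scaledCube ε T) (pairwise_disjoint_scaledCube hε hT),
      iUnion_scaledCube hε hT, setLIntegral_univ]
  rw [hsum, hsum (fun x => ‖f x‖ₑ ^ 2), ← ENNReal.tsum_mul_left]
  refine ENNReal.tsum_le_tsum fun l => ?_
  have e1 : ∫⁻ x in scaledCube ε T l, ‖N.coarse univ ε (fun i => cellAverage ε f i.1) x‖ₑ ^ 2
      = ENNReal.ofReal (N.blockMean (fun i => cellAverage ε f i.1) l ^ 2 * (ε * T) ^ d) := by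
    rw [ENNReal.ofReal_mul (sq_nonneg _), ← volume_scaledCube hε.le T l, ← setLIntegral_const]
    refine setLIntegral_congr_fun (measurableSet_scaledCube _ _ _) fun x hx => ?_
    rw [N.coarse_of_subset hε hT _ hx (subset_univ _), enorm_sq_eq_ofReal]
  have e2 : ∫⁻ x in scaledCube ε T l, ‖f x‖ₑ ^ 2
      = ENNReal.ofReal (∫ x in scaledCube ε T l, f x ^ 2) := by
    rw [ofReal_integral_eq_lintegral_ofReal hf.integrable_sq.integrableOn
      (Eventually.of_forall fun x => sq_nonneg _)]
    simp only [enorm_sq_eq_ofReal]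
  have hI : 0 ≤ ∫ x in scaledCube ε T l, f x ^ 2 := integral_nonneg fun x => sq_nonneg _
  rw [e1, e2, ← ENNReal.ofReal_pow (by positivity), ← ENNReal.ofReal_mul (by positivity)]
  refine ENNReal.ofReal_le_ofReal ?_
  calc N.blockMean (fun i => cellAverage ε f i.1) l ^ 2 * (ε * T) ^ d
      ≤ ((ε ^ d)⁻¹ * ∫ x in scaledCube ε T l, f x ^ 2) * (ε * T) ^ d := by
        gcongr; exact hmean l
    _ = T ^ d * ∫ x in scaledCube ε T l, f x ^ 2 := by
        rw [mul_pow]; field_simp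
    _ ≤ (T ^ d) ^ 2 * ∫ x in scaledCube ε T l, f x ^ 2 := by
        refine mul_le_mul_of_nonneg_right ?_ hI
        nlinarith

/-- The cubes that meet a compact subset of an open set are contained in the open set, once they
are small enough. -/
theorem eventually_scaledCube_subset {K Ω : Set (EuclideanSpace ℝ (Fin d))} (hK : IsCompact K)
    (hΩ : IsOpen Ω) (hKΩ : K ⊆ Ω) :
    ∀ᶠ ε : ℝ in 𝓝[>] 0, ∀ l : Fin d → ℤ, ∀ x ∈ K, x ∈ scaledCube ε T l →
      scaledCube ε T l ⊆ Ω := by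
  obtain ⟨ρ, hρ, hsub⟩ := hK.exists_cthickening_subset_open hΩ hKΩ
  filter_upwards [eventually_mul_lt (c := d * T) hρ, eventually_pos_nhdsGT] with ε h1 hε l x hx hxl
  refine (scaledCube_subset_closedBall hε.le hxl).trans (Subset.trans ?_ hsub)
  refine (Metric.closedBall_subset_closedBall ?_).trans
    (Metric.closedBall_subset_cthickening hx ρ)
  linarith

/-- The cell averages of a function in `L²` converge to that function: by the uniform `L²` bound,
it is enough to treat continuous functions with compact support. -/
theorem convergesTo_cellAverage (hT : 1 ≤ T) (hX : N.X.Nonempty)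
    {Ω : Set (EuclideanSpace ℝ (Fin d))} (hΩ : IsOpen Ω)
    {f : EuclideanSpace ℝ (Fin d) → ℝ} (hf : MemLp f 2 volume) :
    N.ConvergesTo Ω (fun ε i => cellAverage ε f i.1) f := by
  intro K hK hKΩ
  have hb : (0 : ℝ) < N.cell.card := by exact_mod_cast N.cell_card_pos hT hX
  rw [ENNReal.tendsto_nhds_zero]
  intro η hη
  set D : ENNReal := ENNReal.ofReal ((T : ℝ) ^ d) + 1 with hD
  have hDtop : D ≠ ⊤ := by simp [hD]
  have hη1 : η / 2 / D ≠ 0 := (ENNReal.div_pos (ENNReal.div_pos hη.ne' (by simp)).ne' hDtop).ne'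
  obtain ⟨g, hgc, hfg, hgcont, hgL⟩ := hf.exists_hasCompactSupport_eLpNorm_sub_le (by simp) hη1
  obtain ⟨c, hc, hcη⟩ := ENNReal.exists_nnreal_pos_mul_lt
    (a := volume K ^ (2 : ENNReal).toReal⁻¹)
    (ENNReal.rpow_ne_top_of_nonneg (by simp) hK.measure_lt_top.ne)
    (b := η / 2) (ENNReal.div_pos hη.ne' (by simp)).ne'
  obtain ⟨τ, hτ, hgτ⟩ := Metric.uniformContinuous_iff.1
    (hgc.uniformContinuous_of_continuous hgcont) c hc
  filter_upwards [eventually_mul_lt (c := d * T) hτ, eventually_pos_nhdsGT,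
    eventually_scaledCube_subset (T := T) hK hΩ hKΩ] with ε h1 hε hsub
  -- on `K`, all the cubes that matter are contained in `Ω`
  have e1 : eLpNorm (fun x => N.coarse Ω ε (fun i => cellAverage ε f i.1) x - f x) 2
        (volume.restrict K)
      = eLpNorm (fun x => N.coarse univ ε (fun i => cellAverage ε f i.1) x - f x) 2
        (volume.restrict K) := by
    refine eLpNorm_congr_ae ?_
    filter_upwards [ae_restrict_mem hK.measurableSet] with x hx
    have hxl : x ∈ scaledCube ε T (cubeIndex ε T x) := (mem_scaledCube_iff hε hT).2 rfl
    rw [N.coarse_of_subset hε hT _ hxl (hsub _ x hx hxl),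
      N.coarse_of_subset hε hT _ hxl (subset_univ _)]
  have hcm : ∀ h : EuclideanSpace ℝ (Fin d) → ℝ,
      AEStronglyMeasurable (N.coarse univ ε fun i => cellAverage ε h i.1) (volume.restrict K) :=
    fun h => (N.measurable_coarse _ hε hT _).aestronglyMeasurable
  have e2 : (fun x => N.coarse univ ε (fun i => cellAverage ε f i.1) x - f x)
      = ((N.coarse univ ε fun i => cellAverage ε (f - g) i.1) - (f - g))
        + ((N.coarse univ ε fun i => cellAverage ε g i.1) - g) := by
    funext x
    have : (fun i : Node d k => cellAverage ε (f - g) i.1)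
        = fun i => cellAverage ε f i.1 - cellAverage ε g i.1 := by
      funext i; exact cellAverage_sub hε hf hgL _
    simp only [Pi.add_apply, Pi.sub_apply]
    rw [this, ← N.coarse_sub _ hε hT]
    ring
  have b1 : eLpNorm ((N.coarse univ ε fun i => cellAverage ε (f - g) i.1) - (f - g)) 2
      (volume.restrict K) ≤ η / 2 := by
    calc _ ≤ eLpNorm (N.coarse univ ε fun i => cellAverage ε (f - g) i.1) 2 (volume.restrict K)
          + eLpNorm (f - g) 2 (volume.restrict K) :=
          eLpNorm_sub_le (hcm _) (hf.sub hgL).1.restrict (by norm_num)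
      _ ≤ ENNReal.ofReal (T ^ d) * eLpNorm (f - g) 2 volume + eLpNorm (f - g) 2 volume :=
          add_le_add ((eLpNorm_restrict_le _ _ _ _).trans
            (N.eLpNorm_coarse_cellAverage_le hT hX hε (hf.sub hgL))) (eLpNorm_restrict_le _ _ _ _)
      _ = D * eLpNorm (f - g) 2 volume := by rw [hD, add_mul, one_mul]
      _ ≤ D * (η / 2 / D) := by gcongr
      _ ≤ η / 2 := ENNReal.mul_div_le
  have b2 : eLpNorm ((N.coarse univ ε fun i => cellAverage ε g i.1) - g) 2 (volume.restrict K)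
      ≤ η / 2 := by
    refine (eLpNorm_le_of_ae_bound (C := c) (Eventually.of_forall fun x => ?_)).trans ?_
    · have hxl : x ∈ scaledCube ε T (cubeIndex ε T x) := (mem_scaledCube_iff hε hT).2 rfl
      rw [Pi.sub_apply, N.coarse_of_subset hε hT _ hxl (subset_univ _), N.blockMean_eq,
        Real.norm_eq_abs]
      have e3 : (∑ p ∈ N.cell, cellAverage ε g (p.translate T (cubeIndex ε T x)).1) / N.cell.card
          - g x = (∑ p ∈ N.cell, (cellAverage ε g (p.translate T (cubeIndex ε T x)).1 - g x))
            / N.cell.card := by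
        rw [Finset.sum_sub_distrib, Finset.sum_const, nsmul_eq_mul]
        field_simp
      rw [e3, abs_div, abs_of_pos hb, div_le_iff₀ hb, mul_comm, ← nsmul_eq_mul]
      refine (Finset.abs_sum_le_sum_abs _ _).trans (Finset.sum_le_card_nsmul _ _ _ fun p hp => ?_)
      refine abs_cellAverage_sub_le hε hgL _ fun y hy => ?_
      have hy' := scaledCube_one_subset hε
        (N.translate_mem_block_iff.2 (N.mem_cell.1 hp)).2 hy
      have hd := Metric.mem_closedBall.1 (scaledCube_subset_closedBall hε.le hxl hy')
      rw [← Real.dist_eq]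
      exact (hgτ (lt_of_le_of_lt hd (by linarith))).le
    · rw [Measure.restrict_apply_univ, ENNReal.ofReal_coe_nnreal, mul_comm]
      exact hcη.le
  rw [e1, e2]
  calc _ ≤ _ := eLpNorm_add_le ((hcm _).sub (hf.sub hgL).1.restrict)
          ((hcm _).sub hgL.1.restrict) (by norm_num)
    _ ≤ η / 2 + η / 2 := add_le_add b1 b2
    _ = η := ENNReal.add_halves η

end PeriodicNetwork

namespace PeriodicNetwork

variable {d k T : ℕ} (N : PeriodicNetwork d k T)

/-! ### Sums over nodes and sums over blocks -/

/-- The index of the block over which a node lies. -/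
def _root_.Node.blockIndex (T : ℕ) (i : Node d k) : Fin d → ℤ := fun m => i.1 m / T

theorem mem_block_iff_blockIndex (hT : 1 ≤ T) {l : Fin d → ℤ} {i : Node d k} :
    i ∈ N.block l ↔ i ∈ N.X ∧ i.blockIndex T = l := by
  have hT' : (0 : ℤ) < T := by exact_mod_cast hT
  rw [mem_block_iff, funext_iff]
  refine and_congr_right fun _ => forall_congr' fun m => ?_
  rw [Node.blockIndex, Int.ediv_eq_iff_of_pos hT']
  constructor <;> rintro ⟨h1, h2⟩ <;> constructor <;> linarith

/-- The sum of a function over the blocks with index in `L`, block by block. -/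
theorem sum_blocks_eq (hT : 1 ≤ T) {S : Finset (Node d k)} (L : Finset (Fin d → ℤ))
    (hS : ∀ i, i ∈ S ↔ i ∈ N.X ∧ i.blockIndex T ∈ L) (h : Node d k → ℝ) :
    ∑ i ∈ S, h i = ∑ l ∈ L, ∑ p ∈ N.cell, h (p.translate T l) := by
  classical
  rw [← Finset.sum_product']
  have hmem : ∀ (l : Fin d → ℤ), ∀ p ∈ N.cell, p.translate T l ∈ N.X ∧
      (p.translate T l).blockIndex T = l := fun l p hp =>
    (N.mem_block_iff_blockIndex hT).1 (N.translate_mem_block_iff.2 (N.mem_cell.1 hp))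
  symm
  refine Finset.sum_bij (fun e _ => e.2.translate T e.1) ?_ ?_ ?_ fun _ _ => rfl
  · rintro ⟨l, p⟩ he
    obtain ⟨h1, h2⟩ := Finset.mem_product.1 he
    obtain ⟨h3, h4⟩ := hmem l p h2
    exact (hS _).2 ⟨h3, by rw [h4]; exact h1⟩
  · rintro ⟨l, p⟩ he ⟨l', p'⟩ he' heq
    have h1 := (hmem l p (Finset.mem_product.1 he).2).2
    have h2 := (hmem l' p' (Finset.mem_product.1 he').2).2
    simp only at heq
    rw [heq, h2] at h1
    subst h1
    rw [Node.translate_injective T l' heq]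
  · intro i hi
    obtain ⟨h1, h2⟩ := (hS i).1 hi
    have h3 := (N.mem_block_iff_blockIndex hT).2 ⟨h1, rfl⟩
    rw [block_eq_image] at h3
    obtain ⟨p, hp, hpi⟩ := h3
    exact ⟨(i.blockIndex T, p), Finset.mem_product.2 ⟨h2, N.mem_cell.2 hp⟩, hpi⟩

theorem exists_blocks (hT : 1 ≤ T) (L : Finset (Fin d → ℤ)) :
    ∃ S : Finset (Node d k), ∀ i, i ∈ S ↔ i ∈ N.X ∧ i.blockIndex T ∈ L := by
  have hfin : {i : Node d k | i ∈ N.X ∧ i.blockIndex T ∈ L}.Finite := by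
    refine (L.finite_toSet.biUnion fun l _ => N.block_finite l).subset ?_
    rintro i ⟨h1, h2⟩
    exact mem_biUnion (Finset.mem_coe.2 h2) ((N.mem_block_iff_blockIndex hT).2 ⟨h1, rfl⟩)
  exact ⟨hfin.toFinset, fun i => by simp⟩

/-- The `L²` norm of the coarse-grained difference of two functions that differ only at the nodes
of a finite set. -/
theorem eLpNorm_coarse_sub_sq_le (hT : 1 ≤ T) (hX : N.X.Nonempty)
    (Ω : Set (EuclideanSpace ℝ (Fin d))) {ε : ℝ} (hε : 0 < ε) {S : Finset (Node d k)}
    (hS : (S : Set (Node d k)) ⊆ N.X) {u v : Node d k → ℝ} (huv : ∀ i ∈ N.X, i ∉ S → u i = v i) :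
    eLpNorm (fun x => N.coarse Ω ε u x - N.coarse Ω ε v x) 2 volume ^ 2
      ≤ ENNReal.ofReal ((T : ℝ) ^ d * (ε ^ d * ∑ i ∈ S, (u i - v i) ^ 2)) := by
  classical
  set z : Node d k → ℝ := fun i => u i - v i with hz
  have hb := N.cell_card_pos hT hX
  have hb1 : (1 : ℝ) ≤ N.cell.card := by exact_mod_cast hb
  set L := S.image (Node.blockIndex T) with hL
  have hpt : ∀ x, ‖N.coarse Ω ε u x - N.coarse Ω ε v x‖ₑ ^ 2 ≤
      ∑ l ∈ L, (scaledCube ε T l).indicator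
        (fun _ => ENNReal.ofReal (N.blockMean z l ^ 2)) x := by
    intro x
    have hx : x ∈ scaledCube ε T (cubeIndex ε T x) := (mem_scaledCube_iff hε hT).2 rfl
    rw [N.coarse_sub Ω hε hT, N.coarse_apply hε hT _ hx]
    split_ifs with h
    · by_cases hl : cubeIndex ε T x ∈ L
      · refine le_trans (le_of_eq ?_) (Finset.single_le_sum
          (f := fun l => (scaledCube ε T l).indicator
            (fun _ => ENNReal.ofReal (N.blockMean z l ^ 2)) x) (fun _ _ => zero_le) hl)
        simp only [indicator_of_mem hx, enorm_sq_eq_ofReal]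
        rfl
      · have h0 : N.blockMean z (cubeIndex ε T x) = 0 := by
          rw [blockMean_eq, Finset.sum_eq_zero, zero_div]
          intro p hp
          obtain ⟨h1, h2⟩ := (N.mem_block_iff_blockIndex hT).1
            ((N.translate_mem_block_iff (l := cubeIndex ε T x)).2 (N.mem_cell.1 hp))
          have h3 : p.translate T (cubeIndex ε T x) ∉ S := fun h3 =>
            hl (h2 ▸ Finset.mem_image_of_mem _ h3)
          rw [hz]
          simp only [huv _ h1 h3, sub_self]
        have h0' : N.blockMean (fun i => u i - v i) (cubeIndex ε T x) = 0 := h0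
        rw [h0']
        simp
    · simp
  rw [eLpNorm_two_sq]
  refine (lintegral_mono hpt).trans ?_
  rw [lintegral_finsetSum' _ fun l _ =>
    (measurable_const.indicator (measurableSet_scaledCube ε T l)).aemeasurable]
  simp only [lintegral_indicator (measurableSet_scaledCube ε T _), setLIntegral_const,
    volume_scaledCube hε.le, ← ENNReal.ofReal_mul (sq_nonneg _)]
  rw [← ENNReal.ofReal_sum_of_nonneg fun l _ => by positivity]
  refine ENNReal.ofReal_le_ofReal ?_
  obtain ⟨S', hS'⟩ := N.exists_blocks hT L
  have h1 : ∑ l ∈ L, N.blockMean z l ^ 2 ≤ ∑ i ∈ S, z i ^ 2 := by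
    calc ∑ l ∈ L, N.blockMean z l ^ 2
        ≤ ∑ l ∈ L, ∑ p ∈ N.cell, z (p.translate T l) ^ 2 := by
          refine Finset.sum_le_sum fun l _ => (N.sq_blockMean_le hb z l).trans ?_
          exact div_le_self (Finset.sum_nonneg fun _ _ => sq_nonneg _) hb1
      _ = ∑ i ∈ S', z i ^ 2 := (N.sum_blocks_eq hT L hS' fun i => z i ^ 2).symm
      _ = ∑ i ∈ S, z i ^ 2 := by
          symm
          refine Finset.sum_subset (fun i hi => (hS' i).2 ⟨hS hi, Finset.mem_image_of_mem _ hi⟩)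
            fun i hi hi' => ?_
          rw [hz]
          simp only [huv i ((hS' i).1 hi).1 hi', sub_self]
          norm_num
  rw [← Finset.sum_mul, mul_pow]
  calc (∑ l ∈ L, N.blockMean z l ^ 2) * (ε ^ d * T ^ d)
      ≤ (∑ i ∈ S, z i ^ 2) * (ε ^ d * T ^ d) := by gcongr
    _ = T ^ d * (ε ^ d * ∑ i ∈ S, z i ^ 2) := by ring

/-- Convergence is not affected by changes that are small in the scaled `ℓ²` norm. -/
theorem ConvergesTo.of_sum_sq_sub {N : PeriodicNetwork d k T} (hT : 1 ≤ T) (hX : N.X.Nonempty)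
    {Ω K : Set (EuclideanSpace ℝ (Fin d))} (hK : Bornology.IsBounded K)
    {v w : ℝ → Node d k → ℝ} {f : EuclideanSpace ℝ (Fin d) → ℝ}
    (hf : AEStronglyMeasurable f (volume.restrict Ω)) (hv : N.ConvergesTo Ω v f)
    (hwv : ∀ᶠ ε in 𝓝[>] (0 : ℝ), ∀ i ∈ N.X, latticePoint ε i.1 ∉ K → w ε i = v ε i)
    (hsum : Tendsto (fun ε : ℝ => ε ^ d * ∑ᶠ i ∈ N.nodesIn ε K, (w ε i - v ε i) ^ 2)
      (𝓝[>] 0) (𝓝 0)) : N.ConvergesTo Ω w f := by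
  intro K' hK' hK'Ω
  have h1 : Tendsto (fun ε => eLpNorm (fun x => N.coarse Ω ε (w ε) x - N.coarse Ω ε (v ε) x) 2
      volume) (𝓝[>] 0) (𝓝 0) := by
    have h2 : Tendsto (fun ε : ℝ => ENNReal.ofReal ((T : ℝ) ^ d *
        (ε ^ d * ∑ᶠ i ∈ N.nodesIn ε K, (w ε i - v ε i) ^ 2))) (𝓝[>] 0) (𝓝 0) := by
      have := ENNReal.tendsto_ofReal (hsum.const_mul ((T : ℝ) ^ d))
      simpa using this
    have h3 : Tendsto (fun ε => eLpNorm (fun x => N.coarse Ω ε (w ε) x - N.coarse Ω ε (v ε) x) 2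
        volume ^ 2) (𝓝[>] 0) (𝓝 0) := by
      refine tendsto_of_tendsto_of_tendsto_of_le_of_le' tendsto_const_nhds h2
        (Eventually.of_forall fun _ => zero_le) ?_
      filter_upwards [hwv, eventually_pos_nhdsGT] with ε hε1 hε
      have hfin := N.nodesIn_finite hε hK
      rw [finsum_mem_eq_finite_toFinset_sum _ hfin]
      refine N.eLpNorm_coarse_sub_sq_le hT hX Ω hε (fun i hi => ?_) fun i hi hiS => ?_
      · exact (hfin.mem_toFinset.1 (Finset.mem_coe.1 hi)).1
      · exact hε1 i hi fun hiK => hiS (hfin.mem_toFinset.2 ⟨hi, hiK⟩)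
    have h4 := h3.ennrpow_const (2⁻¹ : ℝ)
    rw [ENNReal.zero_rpow_of_pos (by norm_num)] at h4
    refine h4.congr fun ε => ?_
    rw [← ENNReal.rpow_natCast, ← ENNReal.rpow_mul]
    norm_num
  have h5 := h1.add (hv K' hK' hK'Ω)
  rw [add_zero] at h5
  refine tendsto_of_tendsto_of_tendsto_of_le_of_le' tendsto_const_nhds h5
    (Eventually.of_forall fun _ => zero_le) ?_
  filter_upwards [eventually_pos_nhdsGT] with ε hε
  have e : (fun x => N.coarse Ω ε (w ε) x - f x) =
      (fun x => N.coarse Ω ε (w ε) x - N.coarse Ω ε (v ε) x)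
        + fun x => N.coarse Ω ε (v ε) x - f x := by
    funext x; simp
  have hm : ∀ u : Node d k → ℝ, AEStronglyMeasurable (N.coarse Ω ε u) (volume.restrict K') :=
    fun u => (N.measurable_coarse Ω hε hT u).aestronglyMeasurable
  rw [e]
  refine (eLpNorm_add_le ((hm _).sub (hm _)) ((hm _).sub (hf.mono_measure
    (Measure.restrict_mono hK'Ω le_rfl))) (by norm_num)).trans ?_
  exact add_le_add (eLpNorm_restrict_le _ _ _ _) le_rfl

theorem sum_sq_blockMean_sub_le (hT : 1 ≤ T) {Ω K : Set (EuclideanSpace ℝ (Fin d))} {ε : ℝ}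
    (hε : 0 < ε) (u v : Node d k → ℝ) {L : Finset (Fin d → ℤ)}
    (hLK : ∀ l ∈ L, scaledCube ε T l ⊆ K) (hKΩ : K ⊆ Ω) :
    ENNReal.ofReal ((ε * T) ^ d * ∑ l ∈ L, N.blockMean (fun i => u i - v i) l ^ 2)
      ≤ eLpNorm (fun x => N.coarse Ω ε u x - N.coarse Ω ε v x) 2 (volume.restrict K) ^ 2 := by
  rw [eLpNorm_two_sq]
  calc _ = ∑ l ∈ L, ∫⁻ x in scaledCube ε T l,
        ‖N.coarse Ω ε u x - N.coarse Ω ε v x‖ₑ ^ 2 := by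
        rw [Finset.mul_sum, ENNReal.ofReal_sum_of_nonneg fun l _ => by positivity]
        refine Finset.sum_congr rfl fun l hl => ?_
        rw [mul_comm, ENNReal.ofReal_mul (sq_nonneg _), ← volume_scaledCube hε.le T l,
          ← setLIntegral_const]
        refine (setLIntegral_congr_fun (measurableSet_scaledCube _ _ _) fun x hx => ?_).symm
        rw [N.coarse_sub Ω hε hT, N.coarse_of_subset hε hT _ hx ((hLK l hl).trans hKΩ),
          enorm_sq_eq_ofReal]
    _ = ∫⁻ x in ⋃ l ∈ L, scaledCube ε T l, ‖N.coarse Ω ε u x - N.coarse Ω ε v x‖ₑ ^ 2 := by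
        rw [lintegral_biUnion_finset
          (fun l _ l' _ h => pairwise_disjoint_scaledCube hε hT h)
          fun l _ => measurableSet_scaledCube ε T l]
    _ ≤ _ := lintegral_mono_set (iUnion₂_subset hLK)

/-- Two families of discrete functions with the same limit and bounded energies on `A` are close
in the scaled `ℓ²` norm on compact subsets of `A`: their block means are close by the convergence,
and the oscillation inside the blocks is controlled by the energy. -/
theorem tendsto_sum_sq_sub (hT : 1 ≤ T) (hX : N.X.Nonempty)
    {Ω A K : Set (EuclideanSpace ℝ (Fin d))} (hA : IsOpen A) (hAb : Bornology.IsBounded A)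
    (hAΩ : A ⊆ Ω) (hK : IsCompact K) (hKA : K ⊆ A)
    {u v : ℝ → Node d k → ℝ} {f : EuclideanSpace ℝ (Fin d) → ℝ}
    (hf : AEStronglyMeasurable f (volume.restrict Ω))
    (hu : N.ConvergesTo Ω u f) (hv : N.ConvergesTo Ω v f)
    {C : ℝ} (huC : ∀ᶠ ε in 𝓝[>] (0 : ℝ), N.energy ε A (u ε) ≤ C)
    (hvC : ∀ᶠ ε in 𝓝[>] (0 : ℝ), N.energy ε A (v ε) ≤ C) :
    Tendsto (fun ε : ℝ => ε ^ d * ∑ᶠ i ∈ N.nodesIn ε K, (u ε i - v ε i) ^ 2)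
      (𝓝[>] 0) (𝓝 0) := by
  classical
  have hT0 : (0 : ℝ) < T := by exact_mod_cast hT
  obtain ⟨C₁, P, hC₁, hPX, hP⟩ := N.exists_sum_sq_le_blockMean_add_dirichlet hT hX
  obtain ⟨ρ, hρ, hρA⟩ := hK.exists_cthickening_subset_open hA hKA
  set K' := Metric.cthickening ρ K with hK'
  have hK'c : IsCompact K' := hK.cthickening
  set F : ℝ → ENNReal := fun ε =>
    eLpNorm (fun x => N.coarse Ω ε (u ε) x - N.coarse Ω ε (v ε) x) 2 (volume.restrict K') with hF
  have hF0 : Tendsto F (𝓝[>] 0) (𝓝 0) := by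
    have h5 := (hu K' hK'c (hρA.trans hAΩ)).add (hv K' hK'c (hρA.trans hAΩ))
    rw [add_zero] at h5
    refine tendsto_of_tendsto_of_tendsto_of_le_of_le' tendsto_const_nhds h5
      (Eventually.of_forall fun _ => zero_le) ?_
    filter_upwards [eventually_pos_nhdsGT] with ε hε
    have e : (fun x => N.coarse Ω ε (u ε) x - N.coarse Ω ε (v ε) x) =
        (fun x => N.coarse Ω ε (u ε) x - f x) - fun x => N.coarse Ω ε (v ε) x - f x := by
      funext x; simp
    have hm : ∀ u : Node d k → ℝ, AEStronglyMeasurable (N.coarse Ω ε u) (volume.restrict K') :=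
      fun u => (N.measurable_coarse Ω hε hT u).aestronglyMeasurable
    have hf' : AEStronglyMeasurable f (volume.restrict K') :=
      hf.mono_measure (Measure.restrict_mono (hρA.trans hAΩ) le_rfl)
    rw [hF]
    simp only
    rw [e]
    exact eLpNorm_sub_le ((hm _).sub hf') ((hm _).sub hf') (by norm_num)
  set c₀ : ℝ := ∑ p ∈ N.cell, ∑ x ∈ P, x.eucDist p with hc₀
  have hdist0 : ∀ i j : Node d k, 0 ≤ i.eucDist j := fun i j => Real.sqrt_nonneg _
  have hc₀' : ∀ p ∈ N.cell, ∀ x ∈ P, x.eucDist p ≤ c₀ := by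
    intro p hp x hx
    refine (Finset.single_le_sum (f := fun x => x.eucDist p) (fun _ _ => hdist0 _ _) hx).trans ?_
    exact Finset.single_le_sum (f := fun p => ∑ x ∈ P, x.eucDist p)
      (fun _ _ => Finset.sum_nonneg fun _ _ => hdist0 _ _) hp
  have hlim : Tendsto (fun ε : ℝ => 2 * N.cell.card / (T : ℝ) ^ d * (F ε).toReal ^ 2
      + C₁ * (4 * C) * ε ^ 2) (𝓝[>] 0) (𝓝 0) := by
    have h1 : Tendsto (fun ε => (F ε).toReal) (𝓝[>] 0) (𝓝 0) := by
      have := (ENNReal.tendsto_toReal ENNReal.zero_ne_top).comp hF0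
      rw [ENNReal.toReal_zero] at this
      exact this
    have h2 : Tendsto (fun ε : ℝ => ε ^ 2) (𝓝[>] 0) (𝓝 (0 ^ 2)) :=
      (tendsto_id.pow 2).mono_left nhdsWithin_le_nhds
    have := ((h1.pow 2).const_mul (2 * N.cell.card / (T : ℝ) ^ d)).add (h2.const_mul (C₁ * (4 * C)))
    simpa using this
  refine tendsto_of_tendsto_of_tendsto_of_le_of_le' tendsto_const_nhds hlim ?_ ?_
  · filter_upwards [eventually_pos_nhdsGT] with ε hε
    rw [finsum_mem_eq_finite_toFinset_sum _ (N.nodesIn_finite hε hK.isBounded)]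
    positivity
  filter_upwards [huC, hvC, eventually_pos_nhdsGT, eventually_mul_lt (c := c₀) hρ,
    eventually_mul_lt (c := d * T) hρ, hF0.eventually_lt_const (u := ⊤) ENNReal.zero_lt_top]
    with ε huε hvε hε hε1 hε2 hFε
  set z : Node d k → ℝ := fun i => u ε i - v ε i with hz
  have hfinA := N.nodesIn_finite hε hAb
  have hfinK := N.nodesIn_finite hε hK.isBounded
  set S := hfinA.toFinset with hS
  have hSc : (S : Set (Node d k)) = N.nodesIn ε A := hfinA.coe_toFinset
  have hSX : (S : Set (Node d k)) ⊆ N.X := fun i hi => by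
    rw [hSc] at hi; exact hi.1
  set L := hfinK.toFinset.image (Node.blockIndex T) with hL
  -- the blocks that meet `K` and the translated paths of these blocks stay in `A`
  have hLK : ∀ l ∈ L, ∃ i ∈ N.nodesIn ε K, i ∈ N.block l := by
    intro l hl
    obtain ⟨i, hi, rfl⟩ := Finset.mem_image.1 hl
    have hi' := hfinK.mem_toFinset.1 hi
    exact ⟨i, hi', (N.mem_block_iff_blockIndex hT).2 ⟨hi'.1, rfl⟩⟩
  have hcube : ∀ l ∈ L, scaledCube ε T l ⊆ K' := by
    intro l hl
    obtain ⟨i, hi, hil⟩ := hLK l hl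
    have h1 : latticePoint ε i.1 ∈ scaledCube ε T l :=
      (latticePoint_mem_scaledCube_iff hε).2 hil.2
    refine (scaledCube_subset_closedBall hε.le h1).trans ?_
    refine (Metric.closedBall_subset_closedBall ?_).trans
      (Metric.closedBall_subset_cthickening hi.2 ρ)
    linarith
  have hpath : ∀ l ∈ L, ∀ x ∈ P, x.translate T l ∈ S := by
    intro l hl x hx
    obtain ⟨i, hi, hil⟩ := hLK l hl
    rw [block_eq_image] at hil
    obtain ⟨p, hp, rfl⟩ := hil
    refine hfinA.mem_toFinset.2 ⟨(N.translate_mem_X_iff l).2 (hPX hx), hρA ?_⟩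
    refine Metric.closedBall_subset_cthickening hi.2 ρ ?_
    rw [Metric.mem_closedBall]
    refine (dist_latticePoint_le hε.le _ _).trans ?_
    rw [Node.eucDist_translate]
    have := hc₀' p (N.mem_cell.2 hp) x hx
    nlinarith
  have key := hP S hSX L hpath z
  obtain ⟨S', hS'⟩ := N.exists_blocks hT L
  have h1 : ∑ᶠ i ∈ N.nodesIn ε K, (u ε i - v ε i) ^ 2
      ≤ ∑ l ∈ L, ∑ p ∈ N.cell, z (p.translate T l) ^ 2 := by
    rw [finsum_mem_eq_finite_toFinset_sum _ hfinK, ← N.sum_blocks_eq hT L hS' fun i => z i ^ 2]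
    refine Finset.sum_le_sum_of_subset_of_nonneg (fun i hi => (hS' i).2 ?_)
      fun _ _ _ => sq_nonneg _
    exact ⟨(hfinK.mem_toFinset.1 hi).1, Finset.mem_image_of_mem _ hi⟩
  have h2 : (ε * T) ^ d * ∑ l ∈ L, N.blockMean z l ^ 2 ≤ (F ε).toReal ^ 2 := by
    rw [← ENNReal.toReal_pow]
    refine (ENNReal.ofReal_le_iff_le_toReal (ENNReal.pow_ne_top hFε.ne)).1 ?_
    exact N.sum_sq_blockMean_sub_le hT hε (u ε) (v ε) hcube (hρA.trans hAΩ)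
  have h3 : ε ^ d * N.dirichlet S z ≤ 4 * C * ε ^ 2 := by
    have h4 := N.dirichlet_sub_le hSX (u ε) (v ε)
    rw [N.energy_eq hSc] at huε hvε
    have h5 : ε ^ d / ε ^ 2 * N.dirichlet S z ≤ 4 * C := by
      have : (0 : ℝ) ≤ ε ^ d / ε ^ 2 := by positivity
      nlinarith [mul_le_mul_of_nonneg_left h4 this]
    rwa [div_mul_eq_mul_div, div_le_iff₀ (by positivity)] at h5
  have hεd : 0 < ε ^ d := by positivity
  calc ε ^ d * ∑ᶠ i ∈ N.nodesIn ε K, (u ε i - v ε i) ^ 2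
      ≤ ε ^ d * (2 * N.cell.card * ∑ l ∈ L, N.blockMean z l ^ 2 + C₁ * N.dirichlet S z) :=
        mul_le_mul_of_nonneg_left (h1.trans key) hεd.le
    _ = 2 * N.cell.card / (T : ℝ) ^ d * ((ε * T) ^ d * ∑ l ∈ L, N.blockMean z l ^ 2)
        + C₁ * (ε ^ d * N.dirichlet S z) := by
        rw [mul_pow]; field_simp
    _ ≤ 2 * N.cell.card / (T : ℝ) ^ d * (F ε).toReal ^ 2 + C₁ * (4 * C * ε ^ 2) := by
        gcongr
    _ = _ := by ring

end PeriodicNetwork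

/-! ### Lipschitz boundaries -/

section

variable {d : ℕ}

/-- A Lipschitz boundary is null: near each of its points it is contained in a graph, and a bounded
piece of a graph has infinitely many disjoint translates in a bounded region. -/
theorem volume_frontier_of_hasLipschitzBoundary {A : Set (EuclideanSpace ℝ (Fin d))}
    (hA : HasLipschitzBoundary A) : volume (frontier A) = 0 := by
  refine measure_null_of_locally_null _ fun x hx => ?_
  obtain ⟨r, hr, ν, hν, L, γ, hγ, hAγ⟩ := hA x hx
  set π := (Submodule.span ℝ {ν})ᗮ.orthogonalProjectionOnto with hπ
  set h : EuclideanSpace ℝ (Fin d) → ℝ := fun y => inner ℝ ν y - γ (π y) with hh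
  have hc : Continuous h :=
    (continuous_const.inner continuous_id).sub (hγ.continuous.comp π.continuous)
  have hmemA : ∀ y ∈ Metric.ball x r, (y ∈ A ↔ 0 < h y) := by
    intro y hy
    have := Set.ext_iff.1 hAγ y
    simp only [Set.mem_inter_iff, hy, and_true, Set.mem_ofPred_eq, true_and] at this
    rw [this, hh, sub_pos]
  set G : Set (EuclideanSpace ℝ (Fin d)) := Metric.ball x r ∩ h ⁻¹' {0} with hG
  have hsub : frontier A ∩ Metric.ball x r ⊆ G := by
    rintro y ⟨hyA, hyr⟩
    refine ⟨hyr, ?_⟩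
    rcases lt_trichotomy (h y) 0 with hlt | heq | hgt
    · have hnhds : Metric.ball x r ∩ h ⁻¹' Iio 0 ∈ 𝓝 y :=
        (Metric.isOpen_ball.inter (isOpen_Iio.preimage hc)).mem_nhds ⟨hyr, hlt⟩
      obtain ⟨w, hw, hwA⟩ := mem_closure_iff_nhds.1 hyA.1 _ hnhds
      exact absurd ((hmemA w hw.1).1 hwA) (not_lt.2 (le_of_lt hw.2))
    · exact heq
    · have hnhds : Metric.ball x r ∩ h ⁻¹' Ioi 0 ∈ 𝓝 y :=
        (Metric.isOpen_ball.inter (isOpen_Ioi.preimage hc)).mem_nhds ⟨hyr, hgt⟩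
      refine absurd (mem_interior_iff_mem_nhds.2 (mem_of_superset hnhds fun w hw => ?_)) hyA.2
      exact (hmemA w hw.1).2 hw.2
  have hπν : π ν = 0 := by
    rw [hπ, Submodule.orthogonalProjectionOnto_eq_zero_iff, Submodule.orthogonal_orthogonal]
    exact Submodule.mem_span_singleton_self ν
  have htr : ∀ (t : ℝ) y, h (t • ν + y) = t + h y := by
    intro t y
    simp only [hh, map_add, map_smul, hπν, smul_zero, zero_add, inner_add_right, inner_smul_right,
      real_inner_self_eq_norm_sq, hν]
    ring
  refine ⟨frontier A ∩ Metric.ball x r,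
    inter_mem_nhdsWithin _ (Metric.ball_mem_nhds x hr), measure_mono_null hsub ?_⟩
  refine Measure.addHaar_eq_zero_of_disjoint_translates volume
    (fun n : ℕ => ((n : ℝ) + 1)⁻¹ • ν) ?_ ?_ ?_
  · refine (Metric.isBounded_closedBall (x := (0 : EuclideanSpace ℝ (Fin d))) (r := 1)).subset ?_
    rintro _ ⟨n, rfl⟩
    rw [mem_closedBall_zero_iff, norm_smul, hν, mul_one, Real.norm_of_nonneg (by positivity)]
    exact inv_le_one_of_one_le₀ (by linarith [(Nat.cast_nonneg n : (0 : ℝ) ≤ n)])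
  · intro n m hnm
    refine disjoint_left.2 fun y hy hy' => hnm ?_
    simp only [Set.singleton_add] at hy hy'
    obtain ⟨a, ha, rfl⟩ := hy
    obtain ⟨b, hb, hab⟩ := hy'
    have h1 := congrArg h hab
    simp only [htr] at h1
    rw [ha.2, hb.2, add_zero, add_zero] at h1
    have h2 := inv_injective h1
    have h3 : (m : ℝ) = n := by linarith
    exact_mod_cast h3.symm
  · exact Metric.isOpen_ball.measurableSet.inter (hc.measurable (measurableSet_singleton 0))

end

/-! ### The cut-off and the boundary strip -/

section

variable {d : ℕ}

/-- The cut-off function in terms of the distance `t` to the boundary: it vanishes for `t ≤ δ`,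
equals `1` for `t ≥ 2δ`, and is affine in between. -/
noncomputable def layerCutoff (δ t : ℝ) : ℝ := max 0 (min 1 ((t - δ) / δ))

theorem layerCutoff_nonneg (δ t : ℝ) : 0 ≤ layerCutoff δ t := le_max_left _ _

theorem layerCutoff_le_one (δ t : ℝ) : layerCutoff δ t ≤ 1 :=
  max_le zero_le_one (min_le_left _ _)

theorem layerCutoff_eq_zero {δ t : ℝ} (hδ : 0 < δ) (h : t ≤ δ) : layerCutoff δ t = 0 :=
  max_eq_left (min_le_of_right_le (div_nonpos_of_nonpos_of_nonneg (by linarith) hδ.le))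

theorem layerCutoff_eq_one {δ t : ℝ} (hδ : 0 < δ) (h : 2 * δ ≤ t) : layerCutoff δ t = 1 := by
  have h1 : 1 ≤ (t - δ) / δ := by rw [le_div_iff₀ hδ]; linarith
  rw [layerCutoff, min_eq_left h1, max_eq_right zero_le_one]

theorem abs_layerCutoff_sub_le {δ : ℝ} (hδ : 0 < δ) (s t : ℝ) :
    |layerCutoff δ s - layerCutoff δ t| ≤ |s - t| / δ := by
  have h1 : |layerCutoff δ s - layerCutoff δ t| ≤ |(s - δ) / δ - (t - δ) / δ| := by
    refine (abs_max_sub_max_le_max _ _ _ _).trans (max_le ?_ ?_)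
    · rw [sub_self, abs_zero]; exact abs_nonneg _
    · refine (abs_min_sub_min_le_max _ _ _ _).trans (max_le ?_ le_rfl)
      rw [sub_self, abs_zero]; exact abs_nonneg _
  refine h1.trans (le_of_eq ?_)
  rw [← sub_div, abs_div, abs_of_pos hδ]
  congr 2
  ring

theorem abs_infDist_sub_le_dist (s : Set (EuclideanSpace ℝ (Fin d)))
    (x y : EuclideanSpace ℝ (Fin d)) :
    |Metric.infDist x s - Metric.infDist y s| ≤ dist x y := by
  have := (Metric.lipschitz_infDist_pt s).dist_le_mul x y
  rw [Real.dist_eq, NNReal.coe_one, one_mul] at this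
  exact this

theorem frontier_nonempty_of_isBounded (hd : 1 ≤ d) {A : Set (EuclideanSpace ℝ (Fin d))}
    (hAb : Bornology.IsBounded A) (hA : A.Nonempty) : (frontier A).Nonempty := by
  rw [nonempty_iff_ne_empty]
  intro h
  have hne : Nonempty (Fin d) := ⟨⟨0, hd⟩⟩
  have hnt : Nontrivial (EuclideanSpace ℝ (Fin d)) := inferInstance
  rcases frontier_eq_empty_iff.1 h with h | h
  · exact hA.ne_empty h
  · rw [h] at hAb
    exact NormedSpace.unbounded_univ ℝ _ hAb

/-- The integral of an integrable function over the `δ`-neighbourhood of a closed null set tends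
to zero. -/
theorem tendsto_setIntegral_infDist {V s : Set (EuclideanSpace ℝ (Fin d))}
    (hs : IsClosed s) (hs0 : volume s = 0) (hne : s.Nonempty)
    {G : EuclideanSpace ℝ (Fin d) → ℝ} (hG : IntegrableOn G V) :
    Tendsto (fun δ : ℝ => ∫ x in V ∩ {x | Metric.infDist x s < 3 * δ}, G x) (𝓝[>] 0) (𝓝 0) := by
  have hm : ∀ δ : ℝ, MeasurableSet {x : EuclideanSpace ℝ (Fin d) | Metric.infDist x s < 3 * δ} :=
    fun δ => (isOpen_lt (Metric.continuous_infDist_pt s) continuous_const).measurableSet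
  have e : ∀ δ : ℝ, ∫ x in V ∩ {x | Metric.infDist x s < 3 * δ}, G x
      = ∫ x in V, {x | Metric.infDist x s < 3 * δ}.indicator G x :=
    fun δ => (setIntegral_indicator (hm δ)).symm
  simp only [e]
  have h0 : ∫ _x in V, (0 : ℝ) = 0 := by simp
  suffices h : Tendsto (fun δ : ℝ => ∫ x in V, {x | Metric.infDist x s < 3 * δ}.indicator G x)
      (𝓝[>] 0) (𝓝 (∫ _x in V, (0 : ℝ))) by
    rw [h0] at h
    exact h
  refine tendsto_integral_filter_of_dominated_convergence (fun x => ‖G x‖)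
    (Eventually.of_forall fun δ => (hG.indicator (hm δ)).1)
    (Eventually.of_forall fun δ => Eventually.of_forall fun x => norm_indicator_le_norm_self _ _)
    hG.norm ?_
  have hae : ∀ᵐ x ∂(volume.restrict V), x ∉ s :=
    ae_restrict_of_ae (measure_eq_zero_iff_ae_notMem.1 hs0)
  filter_upwards [hae] with x hx
  have hpos : 0 < Metric.infDist x s := (hs.notMem_iff_infDist_pos hne).1 hx
  refine tendsto_const_nhds.congr' ?_
  filter_upwards [eventually_mul_lt (c := 3) hpos] with δ hδ
  refine (indicator_of_notMem (fun h => ?_) _).symm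
  exact absurd (show Metric.infDist x s < 3 * δ from h) (not_lt.2 hδ.le)

/-- The extension by zero from a union of two sets; their overlap is harmless because the same
function `u` is used on both. -/
theorem memLp_indicator_union {Ω V : Set (EuclideanSpace ℝ (Fin d))} (hΩ : MeasurableSet Ω)
    (hV : MeasurableSet V) {u : EuclideanSpace ℝ (Fin d) → ℝ}
    (h1 : MemLp u 2 (volume.restrict Ω)) (h2 : MemLp u 2 (volume.restrict V)) :
    MemLp ((Ω ∪ V).indicator u) 2 volume := by
  have e : (Ω ∪ V).indicator u = Ω.indicator u + (V \ Ω).indicator u := by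
    rw [← union_sdiff_self, indicator_union_of_disjoint disjoint_sdiff_right]
    rfl
  rw [e]
  exact ((memLp_indicator_iff_restrict hΩ).2 h1).add ((memLp_indicator_iff_restrict
    (hV.diff hΩ)).2 (h2.mono_measure (Measure.restrict_mono sdiff_subset le_rfl)))

end

namespace PeriodicNetwork

variable {d k T : ℕ} (N : PeriodicNetwork d k T)

theorem ConvergesTo.congr_limit {N : PeriodicNetwork d k T} {Ω : Set (EuclideanSpace ℝ (Fin d))}
    {u : ℝ → Node d k → ℝ} {f g : EuclideanSpace ℝ (Fin d) → ℝ} (h : N.ConvergesTo Ω u f)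
    (hfg : EqOn f g Ω) : N.ConvergesTo Ω u g := by
  intro K hK hKΩ
  refine (h K hK hKΩ).congr fun ε => eLpNorm_congr_ae ?_
  filter_upwards [ae_restrict_mem hK.measurableSet] with x hx
  rw [hfg (hKΩ hx)]

end PeriodicNetwork

theorem mainTheorem6 {d k T : ℕ} (hd : 1 ≤ d) (hk : 1 ≤ k) (hT : 1 ≤ T)
    (N : PeriodicNetwork d k T)
    (Ω A : Set (EuclideanSpace ℝ (Fin d)))
    (hΩ : IsOpen Ω) (hΩL : HasLipschitzBoundary Ω)
    (hA : IsOpen A) (hAb : Bornology.IsBounded A) (hAL : HasLipschitzBoundary A) (hAΩ : A ⊆ Ω)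
    (u : EuclideanSpace ℝ (Fin d) → ℝ) (hu : MemH1 Ω u)
    -- the values of `u` outside `Ω` are those of an extension that is `H¹` near the closure of `A`
    (huA : ∃ V : Set (EuclideanSpace ℝ (Fin d)), IsOpen V ∧ closure A ⊆ V ∧ MemH1 V u)
    (uε : ℝ → Node d k → ℝ) (hconv : N.ConvergesTo Ω uε u)
    (hbdd : ∃ C : ℝ, ∀ᶠ ε in 𝓝[>] (0 : ℝ), N.energy ε A (uε ε) ≤ C) :
    ∃ (w : ℝ → ℝ → Node d k → ℝ) (ρ : ℝ → ℝ),
      Tendsto ρ (𝓝[>] 0) (𝓝 0) ∧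
      ∀ δ : ℝ, 0 < δ →
        N.ConvergesTo Ω (w δ) u ∧
        (∀ ε : ℝ, 0 < ε → ∀ i ∈ N.X,
          latticePoint ε i.1 ∈ innerSet A (2 * δ) → w δ ε i = uε ε i) ∧
        (∀ ε : ℝ, 0 < ε → ∀ i ∈ N.X,
          latticePoint ε i.1 ∈ A \ innerSet A δ → w δ ε i = cellAverage ε u i.1) ∧
        limsup (fun ε : ℝ =>
            ((N.energy ε A (w δ ε) - N.energy ε A (uε ε) : ℝ) : EReal)) (𝓝[>] 0)
          ≤ (ρ δ : EReal) := by
  classical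
  by_cases hXA : N.X.Nonempty ∧ A.Nonempty
  swap
  · -- there are no nodes in `A`
    have hno : ∀ ε : ℝ, ∀ i ∈ N.X, latticePoint ε i.1 ∉ A := fun ε i hi hiA =>
      hXA ⟨⟨i, hi⟩, ⟨_, hiA⟩⟩
    refine ⟨fun _ => uε, fun _ => 0, tendsto_const_nhds, fun δ hδ => ⟨hconv,
      fun ε _ i hi h => absurd h.1 (hno ε i hi), fun ε _ i hi h => absurd h.1 (hno ε i hi), ?_⟩⟩
    simp
  obtain ⟨hX, hAne⟩ := hXA
  obtain ⟨V, hV, hAV, huV⟩ := huA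
  obtain ⟨g, hg⟩ := huV.exists_isWeakGradient
  obtain ⟨C', hC'⟩ := hbdd
  obtain ⟨ρ₀, hρ₀, hρ₀V⟩ := hAb.isCompact_closure.exists_cthickening_subset_open hV hAV
  have hballV : ∀ x ∈ A, ∀ r ≤ ρ₀, Metric.closedBall x r ⊆ V := fun x hx r hr =>
    ((Metric.closedBall_subset_closedBall hr).trans
      (Metric.closedBall_subset_cthickening (subset_closure hx) ρ₀)).trans hρ₀V
  -- the function whose cell averages are used, and its discretization `v`
  set f := (Ω ∪ V).indicator u with hf
  have hfL : MemLp f 2 volume :=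
    memLp_indicator_union hΩ.measurableSet hV.measurableSet hu.1 huV.1
  have hfV : EqOn f u V := fun x hx => indicator_of_mem (mem_union_right _ hx) u
  have hfΩ : EqOn f u Ω := fun x hx => indicator_of_mem (mem_union_left _ hx) u
  set v : ℝ → Node d k → ℝ := fun ε i => cellAverage ε f i.1 with hv
  have hvconv : N.ConvergesTo Ω v u :=
    (N.convergesTo_cellAverage hT hX hΩ hfL).congr_limit hfΩ
  have hcell : ∀ᶠ ε : ℝ in 𝓝[>] 0, ∀ i : Node d k, latticePoint ε i.1 ∈ A →
      cellAverage ε u i.1 = v ε i := by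
    filter_upwards [eventually_mul_lt (c := d) hρ₀, eventually_pos_nhdsGT] with ε h1 hε i hi
    rw [hv]
    simp only
    rw [cellAverage_eq hε.le, cellAverage_eq hε.le]
    congr 1
    refine setIntegral_congr_fun (measurableSet_scaledCube _ _ _) fun x hx => (hfV ?_).symm
    refine hballV _ hi (d * ε) h1.le ?_
    have := scaledCube_subset_closedBall hε.le (latticePoint_mem_scaledCube_one hε i.1) hx
    simpa using this
  -- constants of the network
  obtain ⟨R, hR, hER⟩ := N.exists_range
  obtain ⟨K, hK0, hK⟩ := N.exists_a_le hT
  obtain ⟨M, hM⟩ := N.exists_card_near_le (R + d)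
  set G : EuclideanSpace ℝ (Fin d) → ℝ := fun x => ∑ m, g m x ^ 2 with hG
  have hGV : IntegrableOn G V :=
    integrable_finsetSum _ fun m _ => (hg.memLp_grad m).integrable_sq
  set C₁ : ℝ := M * (K * (R + d) ^ 2) * M with hC₁
  have hvbdd : ∀ᶠ ε in 𝓝[>] (0 : ℝ), N.energy ε A (v ε) ≤ C₁ * ∫ x in V, G x := by
    filter_upwards [eventually_mul_lt (c := R + d) hρ₀, eventually_pos_nhdsGT] with ε h1 hε
    have hfin := N.nodesIn_finite hε hAb
    have hSc : (hfin.toFinset : Set (Node d k)) = N.nodesIn ε A := hfin.coe_toFinset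
    have hSX : (hfin.toFinset : Set (Node d k)) ⊆ N.X := fun i hi => by
      rw [hSc] at hi; exact hi.1
    rw [N.energy_eq hSc, hC₁, mul_assoc _ (M : ℝ)]
    refine N.sum_cellAverage_le hg hV.measurableSet hfV subset_rfl hR hER hK0 hK hM hSX hSX hε ?_
    intro i hi
    exact hballV _ (hfin.mem_toFinset.1 hi).2 _ (by linarith)
  set C : ℝ := max C' (C₁ * ∫ x in V, G x) with hC
  have hubdd : ∀ᶠ ε in 𝓝[>] (0 : ℝ), N.energy ε A (uε ε) ≤ C :=
    hC'.mono fun ε h => h.trans (le_max_left _ _)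
  have hvbdd' : ∀ᶠ ε in 𝓝[>] (0 : ℝ), N.energy ε A (v ε) ≤ C :=
    hvbdd.mono fun ε h => h.trans (le_max_right _ _)
  set dist' : EuclideanSpace ℝ (Fin d) → ℝ := fun x => Metric.infDist x (frontier A) with hdist'
  have hdist'c : Continuous dist' := Metric.continuous_infDist_pt _
  -- the compact subsets of `A` that contain the transition layers
  have hKc : ∀ δ : ℝ, 0 < δ → IsCompact (closure A ∩ {x | δ / 2 ≤ dist' x}) ∧
      closure A ∩ {x | δ / 2 ≤ dist' x} ⊆ A := by
    intro δ hδ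
    refine ⟨hAb.isCompact_closure.inter_right (isClosed_le continuous_const hdist'c), ?_⟩
    rintro x ⟨hx, hxδ⟩
    by_contra hxA
    have hxf : x ∈ frontier A := ⟨hx, fun h => hxA (interior_subset h)⟩
    have : dist' x = 0 := Metric.infDist_zero_of_mem hxf
    have hxδ' : δ / 2 ≤ dist' x := hxδ
    linarith
  have hD : ∀ δ : ℝ, 0 < δ → Tendsto (fun ε : ℝ => ε ^ d *
      ∑ᶠ i ∈ N.nodesIn ε (closure A ∩ {x | δ / 2 ≤ dist' x}), (uε ε i - v ε i) ^ 2)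
      (𝓝[>] 0) (𝓝 0) := fun δ hδ =>
    N.tendsto_sum_sq_sub hT hX hA hAb hAΩ (hKc δ hδ).1 (hKc δ hδ).2 hu.1.1 hconv hvconv
      hubdd hvbdd'
  set φ : ℝ → EuclideanSpace ℝ (Fin d) → ℝ := fun δ x => layerCutoff δ (dist' x) with hφ
  set I : ℝ → ℝ := fun δ => ∫ x in V ∩ {x | dist' x < 3 * δ}, G x with hI
  have hIlim : Tendsto I (𝓝[>] 0) (𝓝 0) := tendsto_setIntegral_infDist isClosed_frontier
    (volume_frontier_of_hasLipschitzBoundary hAL) (frontier_nonempty_of_isBounded hd hAb hAne) hGV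
  refine ⟨fun δ ε i => if latticePoint ε i.1 ∈ A then
      cellAverage ε u i.1 + φ δ (latticePoint ε i.1) * (uε ε i - cellAverage ε u i.1)
      else v ε i, fun δ => δ * C + (1 + δ) * (C₁ * I δ) + δ, ?_, ?_⟩
  · have hid : Tendsto (fun δ : ℝ => δ) (𝓝[>] 0) (𝓝 0) := tendsto_id.mono_left nhdsWithin_le_nhds
    have := ((hid.mul_const C).add ((hid.const_add 1).mul (hIlim.const_mul C₁))).add hid
    simpa using this
  intro δ hδ
  set w : ℝ → Node d k → ℝ := fun ε i => if latticePoint ε i.1 ∈ A then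
      cellAverage ε u i.1 + φ δ (latticePoint ε i.1) * (uε ε i - cellAverage ε u i.1)
      else v ε i with hw
  set Kδ := closure A ∩ {x | δ / 2 ≤ dist' x} with hKδ
  have hKδb : Bornology.IsBounded Kδ := (hKc δ hδ).1.isBounded
  have hwA : ∀ᶠ ε : ℝ in 𝓝[>] 0, ∀ i : Node d k, latticePoint ε i.1 ∈ A →
      w ε i = v ε i + φ δ (latticePoint ε i.1) * (uε ε i - v ε i) := by
    filter_upwards [hcell] with ε h i hi
    simp only [hw, if_pos hi, h i hi]
  have hwnot : ∀ ε i, latticePoint ε i.1 ∉ A → w ε i = v ε i := fun ε i hi => by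
    simp only [hw, if_neg hi]
  refine ⟨?_, ?_, ?_, ?_⟩
  · change N.ConvergesTo Ω w u
    refine PeriodicNetwork.ConvergesTo.of_sum_sq_sub hT hX hKδb hu.1.1 hvconv ?_ ?_
    · filter_upwards [hwA] with ε h i _ hi
      by_cases hiA : latticePoint ε i.1 ∈ A
      · have hlt : dist' (latticePoint ε i.1) < δ / 2 :=
          not_le.1 fun h' => hi ⟨subset_closure hiA, h'⟩
        have h0 : φ δ (latticePoint ε i.1) = 0 := layerCutoff_eq_zero hδ (by linarith)
        rw [h i hiA, h0, zero_mul, add_zero]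
      · exact hwnot ε i hiA
    · refine tendsto_of_tendsto_of_tendsto_of_le_of_le' tendsto_const_nhds (hD δ hδ) ?_ ?_
      · filter_upwards [eventually_pos_nhdsGT] with ε hε
        rw [finsum_mem_eq_finite_toFinset_sum _ (N.nodesIn_finite hε hKδb)]
        positivity
      · filter_upwards [eventually_pos_nhdsGT, hwA] with ε hε h
        have hfin := N.nodesIn_finite hε hKδb
        rw [finsum_mem_eq_finite_toFinset_sum _ hfin, finsum_mem_eq_finite_toFinset_sum _ hfin]
        refine mul_le_mul_of_nonneg_left (Finset.sum_le_sum fun i hi => ?_) (by positivity)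
        have hiA := (hKc δ hδ).2 (hfin.mem_toFinset.1 hi).2
        rw [h i hiA, add_sub_cancel_left, mul_pow]
        exact mul_le_of_le_one_left (sq_nonneg _)
          (pow_le_one₀ (layerCutoff_nonneg _ _) (layerCutoff_le_one _ _))
  · intro ε _ i _ hi
    have h1 : φ δ (latticePoint ε i.1) = 1 := layerCutoff_eq_one hδ (le_of_lt hi.2)
    simp only [if_pos hi.1, h1]
    ring
  · intro ε _ i _ hi
    have h1 : φ δ (latticePoint ε i.1) = 0 :=
      layerCutoff_eq_zero hδ (not_lt.1 fun h => hi.2 ⟨hi.1, h⟩)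
    simp only [if_pos hi.1, h1]
    ring
  · refine limsup_le_of_le (by isBoundedDefault) ?_
    -- the coupling term becomes smaller than `δ`
    have hD' : ∀ᶠ ε : ℝ in 𝓝[>] 0, (1 + δ⁻¹) * (M * (K * (R / δ) ^ 2)) *
        (ε ^ d * ∑ᶠ i ∈ N.nodesIn ε Kδ, (uε ε i - v ε i) ^ 2) < δ := by
      have := (hD δ hδ).const_mul ((1 + δ⁻¹) * (M * (K * (R / δ) ^ 2)))
      rw [mul_zero] at this
      exact this.eventually_lt_const hδ
    filter_upwards [hD', hwA, hubdd, eventually_pos_nhdsGT, eventually_mul_lt (c := R + d) hρ₀,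
      eventually_mul_lt (c := R + d) hδ, eventually_mul_lt (c := 2 * R) hδ]
      with ε hDε hwε huε hε hε1 hε2 hε3
    rw [EReal.coe_le_coe_iff]
    have hfin := N.nodesIn_finite hε hAb
    have hfinK := N.nodesIn_finite hε hKδb
    set S := hfin.toFinset with hS
    have hmemS : ∀ i ∈ S, i ∈ N.X ∧ latticePoint ε i.1 ∈ A := fun i hi => hfin.mem_toFinset.1 hi
    have hSc : (S : Set (Node d k)) = N.nodesIn ε A := hfin.coe_toFinset
    have hSX : (S : Set (Node d k)) ⊆ N.X := fun i hi => (hmemS i hi).1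
    set ψ : Node d k → ℝ := fun i => φ δ (latticePoint ε i.1) with hψ
    have hψ0 : ∀ i, 0 ≤ ψ i := fun i => layerCutoff_nonneg _ _
    have hψ1 : ∀ i, ψ i ≤ 1 := fun i => layerCutoff_le_one _ _
    -- the Young parameter `δ` makes the excess over the energy of `uε` at most `δ C`
    have hinterp := N.dirichlet_interpolate_le hSX hψ0 hψ1
      (fun i hi => hwε i (hmemS i hi).2) hδ
    set q : ℝ := ε ^ d / ε ^ 2 with hq
    have hq0 : 0 ≤ q := by positivity
    have hedge : ∀ i j : Node d k, (i, j) ∈ N.E →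
        |dist' (latticePoint ε i.1) - dist' (latticePoint ε j.1)| ≤ ε * R := fun i j h =>
      (abs_infDist_sub_le_dist _ _ _).trans ((dist_latticePoint_le hε.le i j).trans
        (mul_le_mul_of_nonneg_left (hER i j h) hε.le))
    -- the energy of the cell averages in the boundary strip
    have hstrip : q * ∑ i ∈ S, ∑ j ∈ S, N.a i j * ((1 - ψ i) * (v ε i - v ε j) ^ 2)
        ≤ C₁ * I δ := by
      set S' := S.filter fun i => dist' (latticePoint ε i.1) < 2 * δ with hS'
      have hS'S : S' ⊆ S := Finset.filter_subset _ _
      have h1 : ∑ i ∈ S, ∑ j ∈ S, N.a i j * ((1 - ψ i) * (v ε i - v ε j) ^ 2)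
          ≤ ∑ i ∈ S', ∑ j ∈ S, N.a i j * (v ε i - v ε j) ^ 2 := by
        rw [← Finset.sum_subset hS'S]
        · refine Finset.sum_le_sum fun i hi => Finset.sum_le_sum fun j hj => ?_
          refine mul_le_mul_of_nonneg_left ?_ (N.a_nonneg (hSX (hS'S hi)) (hSX hj))
          exact mul_le_of_le_one_left (sq_nonneg _) (by linarith [hψ0 i])
        · intro i hi hi'
          have h2 : 2 * δ ≤ dist' (latticePoint ε i.1) :=
            not_lt.1 fun h => hi' (Finset.mem_filter.2 ⟨hi, h⟩)
          have h3 : ψ i = 1 := layerCutoff_eq_one hδ h2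
          simp [h3]
      refine (mul_le_mul_of_nonneg_left h1 hq0).trans ?_
      rw [hC₁, mul_assoc _ (M : ℝ)]
      refine N.sum_cellAverage_le hg hV.measurableSet hfV inter_subset_left hR hER hK0 hK hM hSX
        (fun i hi => hSX (hS'S hi)) hε ?_
      intro i hi x hx
      obtain ⟨hiS, hilt⟩ := Finset.mem_filter.1 hi
      refine ⟨hballV _ (hmemS i hiS).2 _ (by linarith) hx, ?_⟩
      have h2 := (abs_infDist_sub_le_dist (frontier A) x (latticePoint ε i.1)).trans
        (Metric.mem_closedBall.1 hx)
      have h3 := (abs_le.1 h2).2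
      have h4 : Metric.infDist (latticePoint ε i.1) (frontier A) < 2 * δ := hilt
      show Metric.infDist x (frontier A) < 3 * δ
      linarith
    have hcoup : q * ∑ i ∈ S, ∑ j ∈ S, N.a i j * ((ψ i - ψ j) ^ 2 * (uε ε j - v ε j) ^ 2)
        ≤ M * (K * (R / δ) ^ 2) *
          (ε ^ d * ∑ᶠ i ∈ N.nodesIn ε Kδ, (uε ε i - v ε i) ^ 2) := by
      have hKS : hfinK.toFinset ⊆ S := fun i hi => by
        have hi' := hfinK.mem_toFinset.1 hi
        exact hfin.mem_toFinset.2 ⟨hi'.1, (hKc δ hδ).2 hi'.2⟩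
      have h1 := N.sum_coupling_le hER hK hK0 hM hSX hKS (φ := ψ)
        (z := fun j => uε ε j - v ε j) (c := (ε * R / δ) ^ 2) (sq_nonneg _) ?_ ?_
      · refine (mul_le_mul_of_nonneg_left h1 hq0).trans (le_of_eq ?_)
        rw [finsum_mem_eq_finite_toFinset_sum _ hfinK, hq]
        field_simp
      · intro i _ j _ hij
        rw [← sq_abs]
        refine pow_le_pow_left₀ (abs_nonneg _) ((abs_layerCutoff_sub_le hδ _ _).trans ?_) 2
        exact div_le_div_of_nonneg_right (hedge i j hij) hδ.le
      · -- both endpoints of an edge are in the zone where the cut-off vanishes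
        intro i _ j hj hij hjK
        have h2 : dist' (latticePoint ε j.1) < δ / 2 := by
          refine not_le.1 fun h => hjK (hfinK.mem_toFinset.2 ⟨(hmemS j hj).1, ?_, h⟩)
          exact subset_closure (hmemS j hj).2
        have h3 := (abs_le.1 (hedge i j hij)).2
        have e1 : ψ i = 0 := layerCutoff_eq_zero hδ (by linarith)
        have e2 : ψ j = 0 := layerCutoff_eq_zero hδ (by linarith)
        rw [e1, e2]
    have hδ1 : 0 < 1 + δ⁻¹ := by positivity
    rw [N.energy_eq hSc] at huε ⊢
    rw [N.energy_eq hSc]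
    have h5 := mul_le_mul_of_nonneg_left hinterp hq0
    have h6 := mul_le_mul_of_nonneg_left huε hδ.le
    have h7 := mul_le_mul_of_nonneg_left hstrip (by linarith : 0 ≤ 1 + δ)
    have h8 := mul_le_mul_of_nonneg_left hcoup hδ1.le
    have h9 : q * N.dirichlet S (w ε) ≤ (1 + δ) * (q * N.dirichlet S (uε ε))
        + (1 + δ) * (q * ∑ i ∈ S, ∑ j ∈ S, N.a i j * ((1 - ψ i) * (v ε i - v ε j) ^ 2))
        + (1 + δ⁻¹) * (q * ∑ i ∈ S, ∑ j ∈ S,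
          N.a i j * ((ψ i - ψ j) ^ 2 * (uε ε j - v ε j) ^ 2)) := by
      refine h5.trans (le_of_eq ?_)
      ring
    have h10 : (1 + δ⁻¹) * (M * (K * (R / δ) ^ 2) *
        (ε ^ d * ∑ᶠ i ∈ N.nodesIn ε Kδ, (uε ε i - v ε i) ^ 2)) < δ := by
      rw [← mul_assoc]; exact hDε
    have h11 : q * N.dirichlet S (w ε) - q * N.dirichlet S (uε ε)
        ≤ δ * C + (1 + δ) * (C₁ * I δ) + δ := by linarith
    exact h11
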